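/- All groups are finite. For a group $G$, $\pi(G)$ is the set of prime divisors of $|G|$, and $O_p(G)$ is the largest normal $p$-subgroup of $G$. Subgroups $H$ and $X$ of $G$ permute if $HX=XH$. A subgroup $H$ of $G$ is semipermutable in $G$ if $H$ permutes with every subgroup $X$ of $G$ such that $(|H|,|X|)=1$. It is SS-permutable in $G$ if there is a subgroup $K$ of $G$ with $G=HK$ such that $H$ permutes with every Sylow subgroup of $K$. A group $G$ is a BT-group (resp. an SST-group) if for all subgroups $H\le K\le G$ such that $H$ is semipermutable (resp. SS-permutable) in $K$ and $K$ is semipermutable (resp. SS-permutable) in $G$, the subgroup $H$ is semipermutable (resp. SS-permutable) in $G$. The nilpotent residual of $G$ is the smallest normal subgroup $L$ of $G$ such that $G/L$ is nilpotent. For subgroups $K,L\le G$, $\langle K^L\rangle$ denotes the subgroup generated by all conjugates of $K$ by elements of $L$; for $x\in G$ and $H\le G$, $[x,H]$ denotes the subgroup generated by the commutators $[x,h]$ with $h\in H$. **Theorem F.** Let $G$ be a finite solvable BT-group with nilpotent residual $L$. Then the following statements are equivalent: (1) $G$ is an SST-group. (2) For every prime $p\in\pi(G)\setminus\pi(L)$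 and every $p$-subgroup $P$ of $G$, there is a $p$-subgroup $K_p$ of $G$ such that the product set $PK_p$ is a Sylow $p$-subgroup of $G$ and $[P,\langle K_p^L\rangle]\le O_p(G)$. (3) For every prime $p\in\pi(G)\setminus\pi(L)$ and every $p$-element $x$ of $G$, there is a $p$-subgroup $K_p$ of $G$ such that the product set $\langle x\rangle K_p$ is a Sylow $p$-subgroup of $G$ and $[x,\langle K_p^L\rangle]\le O_p(G)$. -/

import Mathlib

open scoped Pointwise

namespace SSPerm

variable {G : Type*} [Group G]

/-- `H` permutes with `K`: `HK = KH` as subsets of the group. -/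
def Permutes (H K : Subgroup G) : Prop :=
  (H : Set G) * (K : Set G) = (K : Set G) * (H : Set G)

/-- `K` is a supplement of `H` in `G`: `HK = G`. -/
def IsSupplement (H K : Subgroup G) : Prop :=
  (H : Set G) * (K : Set G) = Set.univ

/-- `H` is semipermutable in `G`: it permutes with every subgroup of order coprime to `|H|`. -/
def IsSemipermutable (H : Subgroup G) : Prop :=
  ∀ X : Subgroup G, (Nat.card H).Coprime (Nat.card X) → Permutes H X

/-- `H` is SS-permutable in `G`: it has a supplement `K` in `G` such that `H` permutes with
every Sylow subgroup of `K`. -/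
def IsSSPermutable (H : Subgroup G) : Prop :=
  ∃ K : Subgroup G, IsSupplement H K ∧
    ∀ p : ℕ, p.Prime → ∀ Q : Sylow p K, Permutes H ((Q : Subgroup K).map K.subtype)

variable (G)

/-- `G` is a BT-group: semipermutability is a transitive relation on its subgroups. -/
def IsBTGroup : Prop :=
  ∀ H K : Subgroup G, H ≤ K → IsSemipermutable (H.subgroupOf K) → IsSemipermutable K →
    IsSemipermutable H

/-- `G` is an SST-group: SS-permutability is a transitive relation on its subgroups. -/
def IsSSTGroup : Prop :=
  ∀ H K : Subgroup G, H ≤ K → IsSSPermutable (H.subgroupOf K) → IsSSPermutable K →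
    IsSSPermutable H

/-- The nilpotent residual of `G`: the intersection of all normal subgroups with nilpotent
quotient (for finite `G`, the smallest such subgroup). -/
def nilpotentResidual : Subgroup G :=
  sInf {N : Subgroup G | ∃ _ : N.Normal, Group.IsNilpotent (G ⧸ N)}

/-- `O_p(G)`: the subgroup generated by all normal `p`-subgroups of `G`
(for finite `G`, the largest normal `p`-subgroup). -/
def pCore (p : ℕ) : Subgroup G :=
  sSup {N : Subgroup G | N.Normal ∧ IsPGroup p N}

variable {G}

/-- `⟨K^L⟩`: the subgroup generated by all conjugates of `K` by elements of `L`. -/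
def conjClosure (K L : Subgroup G) : Subgroup G :=
  ⨆ l : L, K.map (MulAut.conj (l : G)).toMonoidHom

/-- `[x, H]` for an element `x`: the subgroup generated by all
`[x, h] = x⁻¹h⁻¹xh` with `h ∈ H`. -/
def elemCommutator (x : G) (H : Subgroup G) : Subgroup G :=
  Subgroup.closure {g : G | ∃ h ∈ H, x⁻¹ * h⁻¹ * x * h = g}

/-- The product set `PK` is a Sylow `p`-subgroup of `G`. -/
def IsSylowProduct (p : ℕ) (P K : Subgroup G) : Prop :=
  ∃ S : Sylow p G, (S : Set G) = (P : Set G) * (K : Set G)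

end SSPerm

/-! Write L for the nilpotent residual. The argument rests on the structure of a solvable BT-group:
L is abelian, it contains every p-element for p dividing |L|, all its subgroups are normal in G, and
elements of coprime prime power orders prime to |L| commute. So G acts on L by power automorphisms,
which commute, and G' centralises L. For p not dividing |L|, a p-element lies in O_p(G) exactly when
it centralises L (`IsBTGroup.mem_pCore_iff`).

The structure comes from one observation (`IsBTGroup.conj_mem_of_le_normal`): if N is normal and H ≤
N involves every prime of N, then H is semipermutable in G, and elements of order prime to |N|
normalise H. For a normal p-subgroup V, elements of order prime to p thus act on V by powers. Hence
L centralises V, and every nilpotent normal subgroup; climbing the derived series shows that L is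
abelian.

(1) ⇒ (2): a Sylow p-subgroup is SS-permutable, so by transitivity each p-subgroup P is. A
supplement K of P has p-power index, so it contains L, and the L-conjugates of a Sylow subgroup Q of
K are again Sylow in K. Each generates a p-group with P, so the relevant commutators are p-elements
of G', hence lie in O_p(G). (2) ⇒ (3) is the cyclic case.

(3) ⇒ (1): every subgroup H turns out to be SS-permutable. If k lies in the cofactor of x and l in L
has prime order, then x commutes with [k, l], because their commutator lies in O_p(G) ∩ L = 1. So k
centralises l whenever x does not. Playing such relations against each other shows that a Sylow
p-subgroup is generated modulo O_p(G) by any element outside O_p(G)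
(`IsBTGroup.exists_zpow_mul_mem_pCore`). An intersection of subgroups C_p O_p(G), with C_p a normal
p-complement, then supplements H as required. -/

namespace SSPerm

open scoped commutatorElement

/-! ### Elements of prime power order -/

section Generic

variable {G : Type*} [Group G]

/-- `x` is a `p`-element: its order is a power of `p`. -/
def IsPElement (p : ℕ) (x : G) : Prop := ∃ k : ℕ, x ^ p ^ k = 1

theorem IsPElement.map {H : Type*} [Group H] {p : ℕ} {x : G} (hx : IsPElement p x) (f : G →* H) :
    IsPElement p (f x) := by
  obtain ⟨k, hk⟩ := hx
  exact ⟨k, by rw [← map_pow, hk, map_one]⟩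

theorem IsPElement.conj {p : ℕ} {x : G} (hx : IsPElement p x) (g : G) :
    IsPElement p (g * x * g⁻¹) :=
  hx.map (MulAut.conj g).toMonoidHom

theorem IsPElement.pow {p : ℕ} {x : G} (hx : IsPElement p x) (n : ℕ) : IsPElement p (x ^ n) := by
  obtain ⟨k, hk⟩ := hx
  exact ⟨k, by rw [← pow_mul, mul_comm, pow_mul, hk, one_pow]⟩

theorem IsPElement.zpow {p : ℕ} {x : G} (hx : IsPElement p x) (n : ℤ) : IsPElement p (x ^ n) := by
  obtain ⟨k, hk⟩ := hx
  exact ⟨k, by rw [← zpow_natCast, ← zpow_mul, mul_comm, zpow_mul, zpow_natCast, hk, one_zpow]⟩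

theorem _root_.IsPGroup.isPElement {p : ℕ} {P : Subgroup G} (hP : IsPGroup p P) {x : G}
    (hx : x ∈ P) : IsPElement p x := by
  obtain ⟨k, hk⟩ := isPGroup_iff_pow_pow_eq_one.1 hP ⟨x, hx⟩
  exact ⟨k, by simpa using congrArg Subtype.val hk⟩

theorem isPGroup_of_forall_isPElement {p : ℕ} {P : Subgroup G}
    (h : ∀ x ∈ P, IsPElement p x) : IsPGroup p P :=
  isPGroup_iff_pow_pow_eq_one.2 fun x ↦ (h x x.2).imp fun k hk ↦ Subtype.ext (by simpa using hk)

theorem IsPElement.isPGroup_zpowers {p : ℕ} {x : G} (hx : IsPElement p x) :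
    IsPGroup p (Subgroup.zpowers x) := by
  refine isPGroup_of_forall_isPElement ?_
  rintro _ ⟨n, rfl⟩
  exact hx.zpow n

theorem IsPElement.exists_sylow {p : ℕ} {x : G} (hx : IsPElement p x) :
    ∃ S : Sylow p G, x ∈ S := by
  obtain ⟨S, hS⟩ := hx.isPGroup_zpowers.exists_le_sylow
  exact ⟨S, hS (Subgroup.mem_zpowers x)⟩

/-- If `x ^ m` lies in a subgroup and so does `x ^ n`, with `m` and `n` coprime, then `x` does. -/
theorem mem_of_zpow_mem_of_isCoprime {H : Subgroup G} {x : G} {m n : ℤ} (h : IsCoprime m n)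
    (hm : x ^ m ∈ H) (hn : x ^ n ∈ H) : x ∈ H := by
  obtain ⟨a, b, hab⟩ := h
  have : x = (x ^ m) ^ a * (x ^ n) ^ b := by
    rw [← zpow_mul, ← zpow_mul, ← zpow_add, mul_comm m, mul_comm n, hab, zpow_one]
  rw [this]
  exact H.mul_mem (H.zpow_mem hm a) (H.zpow_mem hn b)

theorem mem_of_pow_mem_of_coprime {H : Subgroup G} {x : G} {m n : ℕ} (h : m.Coprime n)
    (hm : x ^ m ∈ H) (hn : x ^ n ∈ H) : x ∈ H :=
  mem_of_zpow_mem_of_isCoprime (Nat.isCoprime_iff_coprime.2 h) (by simpa using hm)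
    (by simpa using hn)

theorem eq_one_of_pow_eq_one_of_coprime {x : G} {m n : ℕ} (h : m.Coprime n)
    (hm : x ^ m = 1) (hn : x ^ n = 1) : x = 1 :=
  Subgroup.mem_bot.1 <| mem_of_pow_mem_of_coprime h (Subgroup.mem_bot.2 hm) (Subgroup.mem_bot.2 hn)

theorem IsPElement.eq_one_of_pow_eq_one {p m : ℕ} {x : G} (hx : IsPElement p x)
    (hm : x ^ m = 1) (h : p.Coprime m) : x = 1 := by
  obtain ⟨k, hk⟩ := hx
  exact eq_one_of_pow_eq_one_of_coprime (h.pow_left k) hk hm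

theorem IsPElement.eq_one_of_mem {p : ℕ} (hp : p.Prime) {x : G} (hx : IsPElement p x)
    {H : Subgroup G} (hxH : x ∈ H) (h : ¬ p ∣ Nat.card H) : x = 1 := by
  refine hx.eq_one_of_pow_eq_one (m := Nat.card H) ?_ ((Nat.Prime.coprime_iff_not_dvd hp).2 h)
  exact congrArg Subtype.val (pow_card_eq_one' (x := (⟨x, hxH⟩ : H)))

theorem IsPElement.mem_of_zpow_mem {p : ℕ} (hp : p.Prime) {x : G} (hx : IsPElement p x)
    {H : Subgroup G} {n : ℤ} (hn : ¬ (p : ℤ) ∣ n) (h : x ^ n ∈ H) : x ∈ H := by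
  obtain ⟨k, hk⟩ := hx
  refine mem_of_zpow_mem_of_isCoprime (m := n) (n := (p : ℤ) ^ k) ?_ h ?_
  · exact (((Nat.prime_iff_prime_int.1 hp).coprime_iff_not_dvd.2 hn).pow_left).symm
  · have : x ^ ((p : ℤ) ^ k) = 1 := by exact_mod_cast hk
    rw [this]
    exact H.one_mem

theorem pow_conj_eq_zpow_pow {g v : G} {a : ℤ} (h : g * v * g⁻¹ = v ^ a) (m : ℕ) :
    g ^ m * v * (g ^ m)⁻¹ = v ^ a ^ m := by
  induction m with
  | zero => simp
  | succ m ih =>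
    have : g ^ (m + 1) * v * (g ^ (m + 1))⁻¹ = g * (g ^ m * v * (g ^ m)⁻¹) * g⁻¹ := by
      rw [pow_succ']; group
    rw [this, ih, ← conj_zpow, h, ← zpow_mul, pow_succ']

/-- An integer congruent to `1` modulo `p`, a power of which with exponent prime to `p` is
congruent to `1` modulo `p ^ k`, is congruent to `1` modulo `p ^ k`. -/
theorem pow_dvd_sub_one_of_coprime {p k m : ℕ} (hp : p.Prime) (hm : p.Coprime m) {a : ℤ}
    (ha : (p : ℤ) ∣ a - 1) (h : (p : ℤ) ^ k ∣ a ^ m - 1) : (p : ℤ) ^ k ∣ a - 1 := by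
  rw [← mul_geom_sum] at h
  refine IsCoprime.dvd_of_dvd_mul_right (IsCoprime.pow_left ?_) h
  refine (Nat.prime_iff_prime_int.1 hp).coprime_iff_not_dvd.2 fun hd ↦ ?_
  have h1 : (∑ i ∈ Finset.range m, a ^ i) ≡ m [ZMOD p] := by
    have ha' : a ≡ 1 [ZMOD p] := (Int.modEq_iff_dvd.2 ha).symm
    have : (∑ i ∈ Finset.range m, a ^ i) ≡ ∑ i ∈ Finset.range m, 1 [ZMOD p] :=
      Int.ModEq.sum fun i _ ↦ by simpa using ha'.pow i
    simpa using this
  have h2 : (p : ℤ) ∣ m := (Int.ModEq.dvd_iff h1).1 hd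
  exact (Nat.Prime.coprime_iff_not_dvd hp).1 hm (Int.natCast_dvd_natCast.1 h2)

/-- Units congruent to 1 modulo p form a p-group modulo the order of v, so such an exponent of order
prime to p is trivial. This is the rigidity used for every coprime action below. -/
theorem zpow_eq_self_of_modEq_one {p m : ℕ} (hp : p.Prime) (hm : p.Coprime m) {v : G}
    (hv : IsPElement p v) {a : ℤ} (ha : (p : ℤ) ∣ a - 1) (h : v ^ a ^ m = v) : v ^ a = v := by
  have := Fact.mk hp
  obtain ⟨k, hk⟩ := hv
  obtain ⟨j, -, hj⟩ := (Nat.dvd_prime_pow hp).1 (orderOf_dvd_of_pow_eq_one hk)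
  have h1 : (p : ℤ) ^ j ∣ a ^ m - 1 := by
    have : (orderOf v : ℤ) ∣ a ^ m - 1 := by
      rw [orderOf_dvd_iff_zpow_eq_one, zpow_sub, h, zpow_one, mul_inv_cancel]
    simpa [hj] using this
  have h2 : (orderOf v : ℤ) ∣ a - 1 := by
    rw [hj]
    exact_mod_cast pow_dvd_sub_one_of_coprime hp hm ha h1
  rw [orderOf_dvd_iff_zpow_eq_one, zpow_sub, zpow_one] at h2
  exact mul_inv_eq_one.1 h2

theorem mem_zpowers_conj_iff {g v : G} :
    g * v * g⁻¹ ∈ Subgroup.zpowers v ↔ ∃ a : ℤ, g * v * g⁻¹ = v ^ a := by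
  rw [Subgroup.mem_zpowers_iff]
  exact ⟨fun ⟨a, h⟩ ↦ ⟨a, h.symm⟩, fun ⟨a, h⟩ ↦ ⟨a, h.symm⟩⟩

/-- A `q`-element acting nontrivially by conjugation on the cyclic group generated by a
`p`-element, `p ≠ q`, forces `q ∣ p - 1`. -/
theorem dvd_sub_one_of_not_commute {p q : ℕ} (hp : p.Prime) (hq : q.Prime) (hpq : p ≠ q)
    {x a : G} (hx : IsPElement q x) (ha : IsPElement p a)
    (h : x * a * x⁻¹ ∈ Subgroup.zpowers a) (hc : ¬ Commute x a) : q ∣ p - 1 := by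
  have := Fact.mk hp
  obtain ⟨n, hn⟩ := mem_zpowers_conj_iff.1 h
  obtain ⟨k, hk⟩ := hx
  have hnk : a ^ n ^ q ^ k = a := by
    have := pow_conj_eq_zpow_pow hn (q ^ k)
    rw [hk] at this
    simpa using this.symm
  -- By rigidity the exponent is nontrivial already modulo p, so it is a nontrivial q-element of the
  -- unit group of `ZMod p`.
  have hn1 : ¬ (p : ℤ) ∣ n - 1 := fun hd ↦ hc <| by
    have := zpow_eq_self_of_modEq_one hp
      (((Nat.coprime_primes hp hq).2 hpq).pow_right k) ha hd hnk
    rw [this] at hn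
    exact mul_inv_eq_iff_eq_mul.1 hn
  have ha1 : a ≠ 1 := fun h1 ↦ hc (h1 ▸ Commute.one_right x)
  have hpa : p ∣ orderOf a := by
    obtain ⟨j, hj⟩ := ha
    obtain ⟨i, -, hi⟩ := (Nat.dvd_prime_pow hp).1 (orderOf_dvd_of_pow_eq_one hj)
    rw [hi]
    refine dvd_pow_self p fun h0 ↦ ha1 ?_
    rw [h0, pow_zero, orderOf_eq_one_iff] at hi
    exact hi
  have hd : (p : ℤ) ∣ n ^ q ^ k - 1 := by
    have : (orderOf a : ℤ) ∣ n ^ q ^ k - 1 := by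
      rw [orderOf_dvd_iff_zpow_eq_one, zpow_sub, hnk, zpow_one, mul_inv_cancel]
    exact (Int.natCast_dvd_natCast.2 hpa).trans this
  have hz : (n : ZMod p) ^ q ^ k = 1 := by
    have := (ZMod.intCast_zmod_eq_zero_iff_dvd _ p).2 hd
    push_cast at this
    exact sub_eq_zero.1 this
  have hz1 : (n : ZMod p) ≠ 1 := fun h1 ↦ hn1 <| by
    rw [← ZMod.intCast_zmod_eq_zero_iff_dvd]
    push_cast
    rw [h1, sub_self]
  have hz0 : (n : ZMod p) ≠ 0 := fun h0 ↦ by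
    rw [h0, zero_pow (pow_ne_zero _ hq.ne_zero)] at hz
    exact zero_ne_one hz
  obtain ⟨i, -, hi⟩ := (Nat.dvd_prime_pow hq).1 (orderOf_dvd_of_pow_eq_one hz)
  have hqo : q ∣ orderOf (n : ZMod p) := by
    rw [hi]
    refine dvd_pow_self q fun h0 ↦ hz1 ?_
    rwa [h0, pow_zero, orderOf_eq_one_iff] at hi
  exact hqo.trans (ZMod.orderOf_dvd_card_sub_one hz0)

/-- Splitting an element whose order divides a product of coprime factors. -/
theorem exists_mul_of_pow_mul_eq_one {m n : ℕ} (h : m.Coprime n) {x : G} (hx : x ^ (m * n) = 1) :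
    ∃ u ∈ Subgroup.zpowers x, ∃ v ∈ Subgroup.zpowers x, x = u * v ∧ u ^ m = 1 ∧ v ^ n = 1 := by
  obtain ⟨a, b, hab⟩ := Nat.isCoprime_iff_coprime.2 h
  have hx' : x ^ ((m : ℤ) * n) = 1 := by exact_mod_cast hx
  refine ⟨x ^ (b * n), ⟨_, rfl⟩, x ^ (a * m), ⟨_, rfl⟩, ?_, ?_, ?_⟩
  · rw [← zpow_add, add_comm, hab, zpow_one]
  · rw [← zpow_natCast, ← zpow_mul, show b * n * m = m * n * b by ring, zpow_mul, hx', one_zpow]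
  · rw [← zpow_natCast, ← zpow_mul, show a * m * n = m * n * a by ring, zpow_mul, hx', one_zpow]

/-! ### Product sets of subgroups -/

/-- Every coset of K in T = HK has a representative in H, so the embedding of H/(H ∩ K) into T/K is
onto. -/
theorem relIndex_eq_of_coe_eq_mul {T H K : Subgroup G} (h : (T : Set G) = (H : Set G) * K) :
    K.relIndex T = K.relIndex H := by
  have hH : H ≤ T := fun x hx ↦ by
    have : x ∈ (H : Set G) * K := ⟨x, hx, 1, K.one_mem, mul_one x⟩
    rwa [← h] at this
  symm
  refine Nat.card_eq_of_bijective (Subgroup.quotientSubgroupOfEmbeddingOfLE K hH)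
    ⟨(Subgroup.quotientSubgroupOfEmbeddingOfLE K hH).injective, fun t ↦ ?_⟩
  induction t using QuotientGroup.induction_on with
  | H t =>
    obtain ⟨x, hx, k, hk, hxk⟩ : (t : G) ∈ (H : Set G) * K := h ▸ t.2
    refine ⟨((⟨x, hx⟩ : H) : H ⧸ K.subgroupOf H), ?_⟩
    rw [Subgroup.quotientSubgroupOfEmbeddingOfLE_apply_mk]
    refine QuotientGroup.eq.2 ?_
    rw [Subgroup.mem_subgroupOf]
    have : x⁻¹ * (t : G) = k := by rw [← hxk]; group
    simpa [this] using hk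

theorem card_dvd_of_coe_eq_mul [Finite G] {T H K : Subgroup G}
    (h : (T : Set G) = (H : Set G) * K) : Nat.card T ∣ Nat.card H * Nat.card K := by
  have hK : K ≤ T := fun x hx ↦ by
    have : x ∈ (H : Set G) * K := ⟨1, H.one_mem, x, hx, one_mul x⟩
    rwa [← h] at this
  have h1 := (K.subgroupOf T).index_mul_card
  rw [Nat.card_congr (Subgroup.subgroupOfEquivOfLe hK).toEquiv] at h1
  rw [← h1]
  refine mul_dvd_mul_right ?_ _
  change K.relIndex T ∣ _
  rw [relIndex_eq_of_coe_eq_mul h]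
  exact Subgroup.index_dvd_card _

theorem permutes_iff_subset {H K : Subgroup G} :
    Permutes H K ↔ ∀ h ∈ H, ∀ k ∈ K, h * k ∈ (K : Set G) * H := by
  refine ⟨fun h x hx y hy ↦ h ▸ Set.mul_mem_mul hx hy, fun h ↦ ?_⟩
  refine Set.Subset.antisymm ?_ ?_
  · rintro _ ⟨x, hx, y, hy, rfl⟩
    exact h x hx y hy
  · rintro _ ⟨y, hy, x, hx, rfl⟩
    obtain ⟨y', hy', x', hx', he⟩ := h x⁻¹ (H.inv_mem hx) y⁻¹ (K.inv_mem hy)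
    refine ⟨x'⁻¹, H.inv_mem hx', y'⁻¹, K.inv_mem hy', ?_⟩
    have := congrArg (·⁻¹) he
    simpa [mul_inv_rev] using this

theorem Permutes.symm {H K : Subgroup G} (h : Permutes H K) : Permutes K H := Eq.symm h

theorem permutes_of_normal_right (H K : Subgroup G) [K.Normal] : Permutes H K :=
  Subgroup.set_mul_normal_comm (H : Set G) K

theorem permutes_of_normal_left (H K : Subgroup G) [H.Normal] : Permutes H K :=
  (permutes_of_normal_right K H).symm

theorem permutes_of_commute {H K : Subgroup G} (h : ∀ x ∈ H, ∀ y ∈ K, Commute x y) :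
    Permutes H K := by
  refine Set.Subset.antisymm ?_ ?_
  · rintro _ ⟨x, hx, y, hy, rfl⟩
    exact ⟨y, hy, x, hx, (h x hx y hy).symm⟩
  · rintro _ ⟨y, hy, x, hx, rfl⟩
    exact ⟨x, hx, y, hy, h x hx y hy⟩

theorem Permutes.coe_sup {H K : Subgroup G} (h : Permutes H K) :
    ((H ⊔ K : Subgroup G) : Set G) = (H : Set G) * K := by
  let T : Subgroup G :=
    { carrier := (H : Set G) * K
      one_mem' := ⟨1, H.one_mem, 1, K.one_mem, mul_one 1⟩
      mul_mem' := by
        rintro _ _ ⟨a, ha, b, hb, rfl⟩ ⟨c, hc, d, hd, rfl⟩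
        obtain ⟨c', hc', b', hb', he⟩ : b * c ∈ (H : Set G) * K := h ▸ Set.mul_mem_mul hb hc
        refine ⟨a * c', H.mul_mem ha hc', b' * d, K.mul_mem hb' hd, ?_⟩
        simp only at he ⊢
        rw [show a * c' * (b' * d) = a * (c' * b') * d by group, he]
        group
      inv_mem' := by
        rintro _ ⟨a, ha, b, hb, rfl⟩
        rw [show (H : Set G) * K = K * H from h]
        exact ⟨b⁻¹, K.inv_mem hb, a⁻¹, H.inv_mem ha, by simp⟩ }
  have hT : H ⊔ K = T := by
    refine le_antisymm (sup_le ?_ ?_) ?_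
    · exact fun x hx ↦ ⟨x, hx, 1, K.one_mem, mul_one x⟩
    · exact fun x hx ↦ ⟨1, H.one_mem, x, hx, one_mul x⟩
    · rintro _ ⟨a, ha, b, hb, rfl⟩
      exact Subgroup.mul_mem_sup ha hb
  rw [hT]
  rfl

end Generic

/-! ### Finite groups and their Sylow subgroups -/

section Finite

variable {G : Type*} [Group G] [Finite G]

theorem eq_top_of_forall_sylow_le {H : Subgroup G}
    (h : ∀ p : ℕ, p.Prime → ∃ P : Sylow p G, (P : Subgroup G) ≤ H) : H = ⊤ := by
  rw [← Subgroup.index_eq_one]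
  by_contra hne
  obtain ⟨p, hp, hd⟩ := Nat.exists_prime_and_dvd hne
  have := Fact.mk hp
  obtain ⟨P, hP⟩ := h p hp
  exact P.not_dvd_index (hd.trans (Subgroup.index_dvd_of_le hP))

theorem eq_top_of_forall_isPElement_mem {H : Subgroup G}
    (h : ∀ p : ℕ, p.Prime → ∀ x : G, IsPElement p x → x ∈ H) : H = ⊤ :=
  eq_top_of_forall_sylow_le fun p hp ↦
    ⟨Classical.arbitrary _, fun x hx ↦ h p hp x ((Sylow.isPGroup' _).isPElement hx)⟩

theorem le_of_forall_isPElement_mem {A B : Subgroup G}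
    (h : ∀ p : ℕ, p.Prime → ∀ x ∈ A, IsPElement p x → x ∈ B) : A ≤ B := by
  rw [← Subgroup.subgroupOf_eq_top]
  refine eq_top_of_forall_isPElement_mem fun p hp x hx ↦ ?_
  exact h p hp x x.2 (hx.map A.subtype)

/-- The x in H with xK ⊆ KH form a submonoid, which is a subgroup by finiteness, and H is generated
by its elements of prime power order. -/
theorem permutes_of_forall_isPElement {H K : Subgroup G}
    (h : ∀ p : ℕ, p.Prime → ∀ x ∈ H, IsPElement p x → ∀ k ∈ K, x * k ∈ (K : Set G) * H) :
    Permutes H K := by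
  let B : Submonoid G :=
    { carrier := {x | x ∈ H ∧ ∀ k ∈ K, x * k ∈ (K : Set G) * H}
      one_mem' := ⟨H.one_mem, fun k hk ↦ ⟨k, hk, 1, H.one_mem, by simp⟩⟩
      mul_mem' := by
        rintro x y ⟨hx, hx'⟩ ⟨hy, hy'⟩
        refine ⟨H.mul_mem hx hy, fun k hk ↦ ?_⟩
        obtain ⟨k₁, hk₁, y₁, hy₁, e₁⟩ := hy' k hk
        obtain ⟨k₂, hk₂, x₂, hx₂, e₂⟩ := hx' k₁ hk₁
        refine ⟨k₂, hk₂, x₂ * y₁, H.mul_mem hx₂ hy₁, ?_⟩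
        simp only at e₁ e₂ ⊢
        rw [← mul_assoc, e₂, mul_assoc, e₁, mul_assoc] }
  let B' : Subgroup G :=
    { B with
      inv_mem' := by
        intro x hx
        have : x⁻¹ = x ^ (orderOf x - 1) := by
          rw [inv_eq_iff_mul_eq_one, ← pow_succ', Nat.sub_add_cancel (orderOf_pos x),
            pow_orderOf_eq_one]
        rw [this]
        exact B.pow_mem hx _ }
  have hle : H ≤ B' := le_of_forall_isPElement_mem fun p hp x hx hpx ↦ ⟨hx, h p hp x hx hpx⟩
  exact permutes_iff_subset.2 fun x hx ↦ (hle hx).2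

theorem commute_of_isNilpotent [Group.IsNilpotent G] {p q : ℕ} (hp : p.Prime) (hq : q.Prime)
    (hpq : p ≠ q) {x y : G} (hx : IsPElement p x) (hy : IsPElement q y) : Commute x y := by
  have := Fact.mk hp
  have := Fact.mk hq
  obtain ⟨P, hP⟩ := hx.exists_sylow
  obtain ⟨Q, hQ⟩ := hy.exists_sylow
  have h := (Group.isNilpotent_of_finite_tfae (G := G)).out 0 3 rfl rfl |>.1 inferInstance
  exact Subgroup.commute_of_normal_of_disjoint (P : Subgroup G) Q (h p ⟨hp⟩ P) (h q ⟨hq⟩ Q)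
    (IsPGroup.disjoint_of_ne p q hpq _ _ P.isPGroup' Q.isPGroup') x y hP hQ

theorem normal_of_forall_sylow_le_normalizer {N : Subgroup G}
    (h : ∀ p : ℕ, p.Prime → ∃ P : Sylow p G, ∀ g ∈ P, ∀ x ∈ N, g * x * g⁻¹ ∈ N) : N.Normal := by
  rw [← Subgroup.normalizer_eq_top_iff]
  refine eq_top_of_forall_sylow_le fun p hp ↦ ?_
  obtain ⟨P, hP⟩ := h p hp
  refine ⟨P, fun g hg ↦ ?_⟩
  rw [Subgroup.mem_normalizer_iff]
  refine fun x ↦ ⟨hP g hg x, fun hx ↦ ?_⟩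
  have := hP g⁻¹ (inv_mem hg) _ hx
  rwa [show g⁻¹ * (g * x * g⁻¹) * g⁻¹⁻¹ = x by group] at this

/-- S normalises SM, and a q-element y with q ≠ p sends s to [y, s]s; these elements together
generate G. -/
theorem sup_normal_of_commutator_mem {p : ℕ} (hp : p.Prime) (S : Sylow p G) (M : Subgroup G)
    [hM : M.Normal] (h : ∀ q : ℕ, q.Prime → q ≠ p → ∀ y : G, IsPElement q y → ∀ s ∈ S, ⁅y, s⁆ ∈ M) :
    ((S : Subgroup G) ⊔ M).Normal := by
  refine normal_of_forall_sylow_le_normalizer fun q hq ↦ ?_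
  by_cases hqp : q = p
  · subst hqp
    refine ⟨S, fun g hg x hx ↦ ?_⟩
    have hg' : g ∈ (S : Subgroup G) ⊔ M := Subgroup.mem_sup_left hg
    exact mul_mem (mul_mem hg' hx) (inv_mem hg')
  · refine ⟨Classical.arbitrary _, fun g hg x hx ↦ ?_⟩
    have hgq : IsPElement q g := (Sylow.isPGroup' _).isPElement hg
    obtain ⟨s, hs, m, hm, rfl⟩ := Subgroup.mem_sup_of_normal_right.1 hx
    rw [show g * (s * m) * g⁻¹ = ⁅g, s⁆ * s * (g * m * g⁻¹) by simp [commutatorElement_def]]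
    exact mul_mem (mul_mem (Subgroup.mem_sup_right (h q hq hqp g hgq s hs))
      (Subgroup.mem_sup_left hs)) (Subgroup.mem_sup_right (hM.conj_mem m hm g))

theorem isNilpotent_quotient_of_commutator_mem {M : Subgroup G} [M.Normal]
    (h : ∀ p q : ℕ, p.Prime → q.Prime → p ≠ q → ∀ x y : G, IsPElement p x → IsPElement q y →
      ⁅x, y⁆ ∈ M) : Group.IsNilpotent (G ⧸ M) := by
  refine (Group.isNilpotent_of_finite_tfae (G := G ⧸ M)).out 0 3 rfl rfl |>.2 fun p hp P ↦ ?_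
  obtain ⟨S, rfl⟩ := Sylow.mapSurjective_surjective (QuotientGroup.mk'_surjective M) p P
  have hn := sup_normal_of_commutator_mem hp.out S M fun q hq hqp y hy s hs ↦
    h q p hq hp.out hqp y s hy (S.isPGroup'.isPElement hs)
  have := hn.map _ (QuotientGroup.mk'_surjective M)
  rwa [Subgroup.map_sup, QuotientGroup.map_mk'_self, sup_bot_eq] at this

/-! ### The nilpotent residual -/

theorem nilpotentResidual_le {G : Type*} [Group G] {M : Subgroup G} [hM : M.Normal] (h : Group.IsNilpotent (G ⧸ M)) :
    nilpotentResidual G ≤ M :=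
  sInf_le ⟨hM, h⟩

instance nilpotentResidual_normal (G : Type*) [Group G] : (nilpotentResidual G).Normal := by
  refine ⟨fun x hx g ↦ ?_⟩
  rw [nilpotentResidual, Subgroup.mem_sInf] at hx ⊢
  rintro N ⟨hN, hnil⟩
  exact hN.conj_mem x (hx N ⟨hN, hnil⟩) g

theorem commutator_mem_nilpotentResidual {p q : ℕ} (hp : p.Prime) (hq : q.Prime) (hpq : p ≠ q)
    {x y : G} (hx : IsPElement p x) (hy : IsPElement q y) : ⁅x, y⁆ ∈ nilpotentResidual G := by
  rw [nilpotentResidual, Subgroup.mem_sInf]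
  rintro N ⟨hN, hnil⟩
  have := commute_of_isNilpotent hp hq hpq (hx.map (QuotientGroup.mk' N))
    (hy.map (QuotientGroup.mk' N))
  rw [← commutatorElement_eq_one_iff_commute, ← map_commutatorElement] at this
  exact (QuotientGroup.eq_one_iff _).1 this

end Finite

/-! ### Subgroups of a normal subgroup under the BT condition -/

section Auxiliary

variable {G : Type*} [Group G]

theorem IsPElement.coprime_orderOf {p q : ℕ} (hp : p.Prime) (hq : q.Prime) (hpq : p ≠ q) {x : G}
    (hx : IsPElement q x) : (orderOf x).Coprime p := by
  obtain ⟨k, hk⟩ := hx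
  exact Nat.Coprime.coprime_dvd_left (orderOf_dvd_of_pow_eq_one hk)
    (((Nat.coprime_primes hq hp).2 hpq.symm).pow_left k)

theorem IsPElement.dvd_orderOf {p : ℕ} (hp : p.Prime) {x : G} (hx : IsPElement p x)
    (h1 : x ≠ 1) : p ∣ orderOf x := by
  by_contra h
  exact h1 (hx.eq_one_of_pow_eq_one (pow_orderOf_eq_one x)
    ((Nat.Prime.coprime_iff_not_dvd hp).2 h))

/-- Only the trivial subgroup of N has order coprime to |H|, so H is semipermutable in N for want of
test subgroups; transitivity through the normal subgroup N lifts this to G. -/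
theorem IsBTGroup.isSemipermutable_of_le_normal (hG : IsBTGroup G) {H N : Subgroup G} [N.Normal]
    (hle : H ≤ N) (hpr : ∀ r : ℕ, r.Prime → r ∣ Nat.card N → r ∣ Nat.card H) :
    IsSemipermutable H := by
  refine hG H N hle (fun X hX ↦ ?_) fun X _ ↦ permutes_of_normal_left N X
  rw [Nat.card_congr (Subgroup.subgroupOfEquivOfLe hle).toEquiv] at hX
  have h1 : Nat.card X = 1 := by
    by_contra hne
    obtain ⟨r, hr, hd⟩ := Nat.exists_prime_and_dvd hne
    exact Nat.not_coprime_of_dvd_of_dvd hr.one_lt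
      (hpr r hr (hd.trans (Subgroup.card_subgroup_dvd_card X))) hd hX
  rw [Subgroup.card_eq_one.1 h1]
  exact permutes_of_normal_right _ _

theorem zpow_eq_one_of_dvd {p : ℕ} {u : G} (hu : u ^ p = 1) {k : ℤ} (hk : (p : ℤ) ∣ k) :
    u ^ k = 1 := by
  obtain ⟨c, rfl⟩ := hk
  rw [zpow_mul, zpow_natCast, hu, one_zpow]

theorem dvd_of_zpow_eq_one {p : ℕ} (hp : p.Prime) {u : G} (hu : u ^ p = 1) (h1 : u ≠ 1) {k : ℤ}
    (hk : u ^ k = 1) : (p : ℤ) ∣ k := by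
  by_contra h
  have hu' : IsPElement p u := ⟨1, by rwa [pow_one]⟩
  exact h1 (Subgroup.mem_bot.1 (hu'.mem_of_zpow_mem hp h (Subgroup.mem_bot.2 hk)))

/-- The elements of exponent `m` of an abelian subgroup. -/
def torsionIn (A : Subgroup G) (hA : ∀ a ∈ A, ∀ b ∈ A, Commute a b) (m : ℕ) : Subgroup G where
  carrier := {x | x ∈ A ∧ x ^ m = 1}
  one_mem' := ⟨A.one_mem, one_pow m⟩
  mul_mem' := fun {a b} ha hb ↦
    ⟨A.mul_mem ha.1 hb.1, by rw [(hA a ha.1 b hb.1).mul_pow, ha.2, hb.2, one_mul]⟩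
  inv_mem' := fun {a} ha ↦ ⟨A.inv_mem ha.1, by rw [inv_pow, ha.2, inv_one]⟩

instance torsionIn_normal {A : Subgroup G} [hn : A.Normal] {hA : ∀ a ∈ A, ∀ b ∈ A, Commute a b}
    {m : ℕ} : (torsionIn A hA m).Normal :=
  ⟨fun x hx g ↦ ⟨hn.conj_mem x hx.1 g, by rw [conj_pow, hx.2]; group⟩⟩

theorem isPGroup_torsionIn {A : Subgroup G} {hA : ∀ a ∈ A, ∀ b ∈ A, Commute a b} {p k : ℕ} :
    IsPGroup p (torsionIn A hA (p ^ k)) :=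
  isPGroup_of_forall_isPElement fun _ hx ↦ ⟨k, hx.2⟩

theorem IsBTGroup.conj_mem_of_le_normal (hG : IsBTGroup G) {H N : Subgroup G} [hN : N.Normal]
    (hle : H ≤ N) (hpr : ∀ r : ℕ, r.Prime → r ∣ Nat.card N → r ∣ Nat.card H) {x : G}
    (hx : (orderOf x).Coprime (Nat.card N)) {h : G} (hh : h ∈ H) : x * h * x⁻¹ ∈ H := by
  have hperm : Permutes H (Subgroup.zpowers x) := by
    refine hG.isSemipermutable_of_le_normal hle hpr _ ?_
    rw [Nat.card_zpowers]
    exact (hx.coprime_dvd_right (Subgroup.card_dvd_of_le hle)).symm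
  obtain ⟨h', hh', _, ⟨i, rfl⟩, he⟩ : x * h ∈ (H : Set G) * Subgroup.zpowers x :=
    hperm ▸ Set.mul_mem_mul (Subgroup.mem_zpowers x) hh
  have he' : x * h * x⁻¹ = h' * x ^ (i - 1) := by
    simp only at he
    rw [← he, zpow_sub_one, mul_assoc]
  -- The stray power of x lies in N, whose order is prime to that of x.
  have hxN : x ^ (i - 1) ∈ N := by
    have := N.mul_mem (N.inv_mem (hle hh')) (hN.conj_mem h (hle hh) x)
    rwa [he', inv_mul_cancel_left] at this
  have h1 : x ^ (i - 1) = 1 := by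
    refine eq_one_of_pow_eq_one_of_coprime hx ?_
      (congrArg Subtype.val (pow_card_eq_one' (x := (⟨_, hxN⟩ : N))))
    rw [← zpow_natCast, ← zpow_mul, mul_comm, zpow_mul, zpow_natCast, pow_orderOf_eq_one, one_zpow]
  rwa [he', h1, mul_one]

theorem isNilpotent_of_commutator_le_centralizer {D : Subgroup G}
    (h : ⁅D, D⁆ ≤ Subgroup.centralizer (D : Set G)) : Group.IsNilpotent D := by
  refine Group.of_quotient_center_nilpotent ?_
  have hc : ∀ a b : D ⧸ Subgroup.center D, a * b = b * a := by
    intro a b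
    induction a using QuotientGroup.induction_on with
    | H a =>
    induction b using QuotientGroup.induction_on with
    | H b =>
    rw [← commutatorElement_eq_one_iff_mul_comm]
    refine (QuotientGroup.eq_one_iff ⁅a, b⁆).2 (Subgroup.mem_center_iff.2 fun g ↦ Subtype.ext ?_)
    exact Subgroup.mem_centralizer_iff.1 (h (Subgroup.commutator_mem_commutator a.2 b.2)) g g.2
  let _ : CommGroup (D ⧸ Subgroup.center D) := { (inferInstance : Group _) with mul_comm := hc }
  infer_instance

end Auxiliary

/-! ### The nilpotent residual of a solvable BT-group -/

section BT

variable {G : Type*} [Group G] [Finite G]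

theorem eq_of_dvd_card_of_isPGroup {p r : ℕ} (hp : p.Prime) (hr : r.Prime) {V : Subgroup G}
    (hV : IsPGroup p V) (h : r ∣ Nat.card V) : r = p := by
  have := Fact.mk hp
  obtain ⟨n, hn⟩ := IsPGroup.iff_card.1 hV
  rw [hn] at h
  exact (Nat.prime_dvd_prime_iff_eq hr hp).1 (hr.dvd_of_dvd_pow h)

theorem IsBTGroup.conj_mem_zpowers (hG : IsBTGroup G) {p : ℕ} (hp : p.Prime) {V : Subgroup G}
    [V.Normal] (hV : IsPGroup p V) {x : G} (hx : (orderOf x).Coprime p) {v : G} (hv : v ∈ V) :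
    x * v * x⁻¹ ∈ Subgroup.zpowers v := by
  by_cases h1 : v = 1
  · simp [h1]
  have := Fact.mk hp
  refine hG.conj_mem_of_le_normal (Subgroup.zpowers_le.2 hv) (fun r hr hd ↦ ?_) ?_
    (Subgroup.mem_zpowers v)
  · rw [Nat.card_zpowers, eq_of_dvd_card_of_isPGroup hp hr hV hd]
    exact (hV.isPElement hv).dvd_orderOf hp h1
  · obtain ⟨n, hn⟩ := IsPGroup.iff_card.1 hV
    rw [hn]
    exact hx.pow_right n

/-- An element of order prime to `p` acts by a single exponent on the elements of order `p` of a
normal `p`-subgroup. -/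
theorem IsBTGroup.exists_uniform_exponent (hG : IsBTGroup G) {p : ℕ} (hp : p.Prime)
    {V : Subgroup G} [V.Normal] (hV : IsPGroup p V) {x : G} (hx : (orderOf x).Coprime p) :
    ∃ n : ℤ, ∀ u ∈ V, u ^ p = 1 → x * u * x⁻¹ = u ^ n := by
  have := Fact.mk hp
  rcases subsingleton_or_nontrivial V with hs | hnt
  · refine ⟨1, fun u hu _ ↦ ?_⟩
    have : u = 1 := congrArg Subtype.val (Subsingleton.elim (⟨u, hu⟩ : V) 1)
    simp [this]
  -- A central element z of order p serves as reference: its exponent is compared with that of u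
  -- through the product zu.
  obtain ⟨z, hzV, hzp, hz1, hzc⟩ :
      ∃ z ∈ V, z ^ p = 1 ∧ z ≠ 1 ∧ ∀ u ∈ V, Commute z u := by
    have := hV.center_nontrivial
    obtain ⟨z, hz⟩ := exists_prime_orderOf_dvd_card' p
      (((hV.to_subgroup (Subgroup.center V)).card_eq_or_dvd).resolve_left
        (Finite.one_lt_card).ne')
    refine ⟨z, z.1.2, ?_, ?_, fun u hu ↦ ?_⟩
    · have := pow_orderOf_eq_one z
      rw [hz] at this
      simpa using congrArg (fun t : Subgroup.center V ↦ ((t : V) : G)) this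
    · intro h
      have : z = 1 := by ext; simpa using h
      rw [this, orderOf_one] at hz
      exact hp.one_lt.ne hz
    · exact (congrArg Subtype.val (Subgroup.mem_center_iff.1 z.2 ⟨u, hu⟩)).symm
  obtain ⟨n, hn⟩ := mem_zpowers_conj_iff.1 (hG.conj_mem_zpowers hp hV hx hzV)
  refine ⟨n, fun u hu hup ↦ ?_⟩
  by_cases huz : u ∈ Subgroup.zpowers z
  · obtain ⟨i, rfl⟩ := huz
    simp only
    rw [← conj_zpow, hn, ← zpow_mul, ← zpow_mul, mul_comm]
  obtain ⟨c, hc⟩ := mem_zpowers_conj_iff.1 (hG.conj_mem_zpowers hp hV hx hu)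
  obtain ⟨d, hd⟩ := mem_zpowers_conj_iff.1 (hG.conj_mem_zpowers hp hV hx (V.mul_mem hzV hu))
  -- Since u is not a power of z, the two are independent, so n and c both agree with d modulo p.
  have e1 : z ^ n * u ^ c = z ^ d * u ^ d := by
    rw [← hn, ← hc, ← (hzc u hu).mul_zpow, ← hd]
    group
  have e2 : u ^ (d - c) = z ^ (n - d) := by
    rw [zpow_sub, sub_eq_neg_add, zpow_add, zpow_neg, eq_inv_mul_iff_mul_eq, ← mul_assoc, ← e1,
      mul_inv_cancel_right]
  have hdc : (p : ℤ) ∣ d - c := by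
    by_contra h
    have hu' : IsPElement p u := ⟨1, by rwa [pow_one]⟩
    exact huz (hu'.mem_of_zpow_mem hp h (e2 ▸ Subgroup.zpow_mem_zpowers z _))
  have hnd : (p : ℤ) ∣ n - d := by
    refine dvd_of_zpow_eq_one hp hzp hz1 ?_
    rw [← e2, zpow_eq_one_of_dvd hup hdc]
  have hnc : u ^ (n - c) = 1 := zpow_eq_one_of_dvd hup (by simpa using dvd_add hnd hdc)
  rw [hc, eq_comm, ← mul_inv_eq_one, ← zpow_sub, hnc]

/-- On elements of order p, x and its conjugates act with the same exponent, so [x, y] acts on v by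
an exponent congruent to 1 modulo p. That exponent is a product of two of order dividing that of x,
hence is trivial by rigidity. -/
theorem IsBTGroup.commutator_mem_centralizer (hG : IsBTGroup G) {p : ℕ} (hp : p.Prime)
    {V : Subgroup G} [hVn : V.Normal] (hV : IsPGroup p V) {x : G} (hx : (orderOf x).Coprime p)
    (y : G) : ⁅x, y⁆ ∈ Subgroup.centralizer (V : Set G) := by
  rw [Subgroup.mem_centralizer_iff]
  intro v hv
  have hv : v ∈ V := hv
  by_cases hv1 : v = 1
  · simp [hv1]
  have hx' : (orderOf (y * x⁻¹ * y⁻¹)).Coprime p := by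
    have : orderOf (y * x⁻¹ * y⁻¹) = orderOf x := by
      rw [← orderOf_inv x]
      exact (MulAut.conj y).orderOf_eq x⁻¹
    rwa [this]
  obtain ⟨a, ha⟩ := mem_zpowers_conj_iff.1 (hG.conj_mem_zpowers hp hV hx hv)
  obtain ⟨b, hb⟩ := mem_zpowers_conj_iff.1 (hG.conj_mem_zpowers hp hV hx' hv)
  have hw : ⁅x, y⁆ * v * ⁅x, y⁆⁻¹ = v ^ (a * b) := by
    rw [show ⁅x, y⁆ * v * ⁅x, y⁆⁻¹ = x * (y * x⁻¹ * y⁻¹ * v * (y * x⁻¹ * y⁻¹)⁻¹) * x⁻¹ by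
      simp [commutatorElement_def, mul_assoc], hb, ← conj_zpow, ha, ← zpow_mul]
  suffices h : v ^ (a * b) = v by
    rw [h] at hw
    exact (mul_inv_eq_iff_eq_mul.1 hw).symm
  have hvp := hV.isPElement hv
  refine zpow_eq_self_of_modEq_one hp hx.symm hvp ?_ ?_
  · obtain ⟨n, hn⟩ := hG.exists_uniform_exponent hp hV hx
    have hpo := hvp.dvd_orderOf hp hv1
    -- A power of v of order p detects the exponent modulo p.
    set u := v ^ (orderOf v / p) with hu
    have huo : orderOf u = p := by
      rw [hu, orderOf_pow_of_dvd (Nat.div_pos (Nat.le_of_dvd (orderOf_pos v) hpo) hp.pos).ne'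
        (Nat.div_dvd_of_dvd hpo), Nat.div_div_self hpo (orderOf_pos v).ne']
    have huV : u ∈ V := V.pow_mem hv _
    have hup : u ^ p = 1 := by rw [← huo, pow_orderOf_eq_one]
    have hu1 : u ≠ 1 := fun h ↦ hp.one_lt.ne' (by rw [← huo, h, orderOf_one])
    refine dvd_of_zpow_eq_one hp hup hu1 ?_
    have e1 : ⁅x, y⁆ * u * ⁅x, y⁆⁻¹ = u ^ (a * b) := by
      rw [hu, ← conj_pow, hw, ← zpow_natCast, ← zpow_natCast, ← zpow_mul, ← zpow_mul, mul_comm]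
    have e2 : x * u * x⁻¹ = y * x * y⁻¹ * u * (y * x * y⁻¹)⁻¹ := by
      have := hn (y⁻¹ * u * y) (by simpa using hVn.conj_mem u huV y⁻¹)
        (by rw [show y⁻¹ * u * y = y⁻¹ * u * y⁻¹⁻¹ by group, conj_pow, hup]; group)
      rw [hn u huV hup, show y * x * y⁻¹ * u * (y * x * y⁻¹)⁻¹
        = y * (x * (y⁻¹ * u * y) * x⁻¹) * y⁻¹ by group, this,
        show y⁻¹ * u * y = y⁻¹ * u * y⁻¹⁻¹ by group, conj_zpow]
      group
    have e3 : ⁅x, y⁆ * u * ⁅x, y⁆⁻¹ = u := by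
      have e4 : y * x⁻¹ * y⁻¹ * (x * u * x⁻¹) * (y * x⁻¹ * y⁻¹)⁻¹ = u := by
        rw [e2]; group
      obtain ⟨c, hc⟩ := mem_zpowers_conj_iff.1 (hG.conj_mem_zpowers hp hV hx huV)
      obtain ⟨d, hd⟩ := mem_zpowers_conj_iff.1 (hG.conj_mem_zpowers hp hV hx' huV)
      rw [hc, ← conj_zpow, hd] at e4
      rw [show ⁅x, y⁆ * u * ⁅x, y⁆⁻¹ = x * (y * x⁻¹ * y⁻¹ * u * (y * x⁻¹ * y⁻¹)⁻¹) * x⁻¹ by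
        simp [commutatorElement_def, mul_assoc], hd, ← conj_zpow, hc, ← zpow_mul, mul_comm,
        zpow_mul, e4]
    rw [zpow_sub_one, ← e1, e3, mul_inv_cancel]
  · have h1 := pow_conj_eq_zpow_pow ha (orderOf x)
    have h2 := pow_conj_eq_zpow_pow hb (orderOf x)
    rw [pow_orderOf_eq_one] at h1
    rw [show (y * x⁻¹ * y⁻¹) ^ orderOf x = 1 by
      rw [conj_pow, inv_pow, pow_orderOf_eq_one]; group] at h2
    rw [mul_pow, zpow_mul, ← h1]
    simpa using h2.symm

/-- Of two elements of coprime prime power orders, at least one has order prime to p, so they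
commute modulo C(V), and G/C(V) is nilpotent. -/
theorem IsBTGroup.nilpotentResidual_le_centralizer_of_isPGroup (hG : IsBTGroup G) {p : ℕ}
    (hp : p.Prime) {V : Subgroup G} [V.Normal] (hV : IsPGroup p V) :
    nilpotentResidual G ≤ Subgroup.centralizer (V : Set G) := by
  refine nilpotentResidual_le (isNilpotent_quotient_of_commutator_mem ?_)
  intro r s hr hs hrs x y hx hy
  by_cases hrp : p = r
  · rw [← commutatorElement_inv]
    exact inv_mem (hG.commutator_mem_centralizer hp hV
      (hy.coprime_orderOf hp hs (hrp ▸ hrs)) x)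
  · exact hG.commutator_mem_centralizer hp hV (hx.coprime_orderOf hp hr hrp) y

/-- The Sylow subgroups of D are characteristic in D, hence normal p-subgroups of G. -/
theorem IsBTGroup.le_centralizer_nilpotentResidual (hG : IsBTGroup G) {D : Subgroup G} [D.Normal]
    (hD : Group.IsNilpotent D) :
    D ≤ Subgroup.centralizer (nilpotentResidual G : Set G) := by
  refine le_of_forall_isPElement_mem fun p hp d hd hpd ↦ ?_
  have := Fact.mk hp
  obtain ⟨P, hP⟩ : ∃ P : Sylow p D, (⟨d, hd⟩ : D) ∈ P := by
    refine IsPElement.exists_sylow ?_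
    obtain ⟨k, hk⟩ := hpd
    exact ⟨k, Subtype.ext (by simpa using hk)⟩
  have hPn : (P : Subgroup D).Normal :=
    (Group.isNilpotent_of_finite_tfae (G := D)).out 0 3 rfl rfl |>.1 hD p ⟨hp⟩ P
  have hPc : (P : Subgroup D).Characteristic := P.characteristic_of_normal hPn
  have hle := hG.nilpotentResidual_le_centralizer_of_isPGroup hp
    (V := (P : Subgroup D).map D.subtype) (P.isPGroup'.map _)
  rw [Subgroup.mem_centralizer_iff]
  intro l hl
  exact (Subgroup.mem_centralizer_iff.1 (hle hl) d ⟨⟨d, hd⟩, hP, rfl⟩).symm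

/-- The nilpotent residual of a solvable BT-group is abelian. -/
theorem IsBTGroup.commute_of_mem_nilpotentResidual (hG : IsBTGroup G) (hs : Group.IsSolvable G)
    {a b : G} (ha : a ∈ nilpotentResidual G) (hb : b ∈ nilpotentResidual G) : Commute a b := by
  obtain ⟨n, hn⟩ := hs.solvable
  -- Going up the derived series: if one term meets L centrally, the intersection of the preceding
  -- term with L has class at most 2, so it is nilpotent and L centralises it.
  have key : ∀ i, i ≤ n → derivedSeries G (n - i) ⊓ nilpotentResidual G ≤
      Subgroup.centralizer (nilpotentResidual G : Set G) := by
    intro i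
    induction i with
    | zero =>
      intro _
      rw [Nat.sub_zero, hn, bot_inf_eq]
      exact bot_le
    | succ i ih =>
      intro hi
      refine hG.le_centralizer_nilpotentResidual (isNilpotent_of_commutator_le_centralizer ?_)
      refine le_trans ?_ ((ih (by omega)).trans (Subgroup.centralizer_le inf_le_right))
      refine le_inf ?_ ((Subgroup.commutator_mono inf_le_right inf_le_right).trans
        (Subgroup.commutator_le_self _))
      rw [show n - i = n - (i + 1) + 1 by omega, derivedSeries_succ]
      exact Subgroup.commutator_mono inf_le_left inf_le_left
  have := key n le_rfl
  rw [Nat.sub_self, derivedSeries_zero, top_inf_eq] at this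
  exact (Subgroup.mem_centralizer_iff.1 (this hb) a ha)

theorem not_dvd_card_torsionIn {A : Subgroup G} {hA : ∀ a ∈ A, ∀ b ∈ A, Commute a b} {p m : ℕ}
    (hp : p.Prime) (h : ¬ p ∣ m) : ¬ p ∣ Nat.card (torsionIn A hA m) := by
  intro hd
  have := Fact.mk hp
  obtain ⟨x, hx⟩ := exists_prime_orderOf_dvd_card' p hd
  have hx1 : x ^ m = 1 := Subtype.ext (by simpa using x.2.2)
  exact h (hx ▸ orderOf_dvd_of_pow_eq_one hx1)

theorem IsBTGroup.conj_mem_zpowers_of_mem_nilpotentResidual (hG : IsBTGroup G)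
    (hs : Group.IsSolvable G) {p : ℕ} (hp : p.Prime) {a : G} (ha : a ∈ nilpotentResidual G)
    (hpa : IsPElement p a) {x : G} (hx : (orderOf x).Coprime p) :
    x * a * x⁻¹ ∈ Subgroup.zpowers a := by
  obtain ⟨k, hk⟩ := hpa
  exact hG.conj_mem_zpowers hp (V := torsionIn (nilpotentResidual G)
    (fun _ ha _ hb ↦ hG.commute_of_mem_nilpotentResidual hs ha hb) (p ^ k)) isPGroup_torsionIn hx
    ⟨ha, hk⟩

theorem IsBTGroup.mem_sylow_of_mem_nilpotentResidual (hG : IsBTGroup G)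
    (hs : Group.IsSolvable G) {p : ℕ} {a : G} (ha : a ∈ nilpotentResidual G)
    (hpa : IsPElement p a) (S : Sylow p G) : a ∈ S := by
  obtain ⟨k, hk⟩ := hpa
  exact (isPGroup_torsionIn (A := nilpotentResidual G)
    (hA := fun _ ha _ hb ↦ hG.commute_of_mem_nilpotentResidual hs ha hb)).le_sylow_of_normal S
    ⟨ha, hk⟩

end BT

/-! ### L is a Hall subgroup on which G acts by power automorphisms -/

section Structure

variable {G : Type*} [Group G] [Finite G]

/-- Otherwise the p'-part M of L would already have nilpotent quotient, contradicting the minimality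
of L. -/
theorem IsBTGroup.exists_not_commute (hG : IsBTGroup G) (hs : Group.IsSolvable G) {p : ℕ}
    (hp : p.Prime) (hd : p ∣ Nat.card (nilpotentResidual G)) :
    ∃ q : ℕ, q.Prime ∧ p ≠ q ∧ ∃ x : G, IsPElement q x ∧
      ∃ a ∈ nilpotentResidual G, IsPElement p a ∧ ¬ Commute x a := by
  have := Fact.mk hp
  by_contra! hall
  have hA : ∀ a ∈ nilpotentResidual G, ∀ b ∈ nilpotentResidual G, Commute a b :=
    fun _ ha _ hb ↦ hG.commute_of_mem_nilpotentResidual hs ha hb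
  have hLn := nilpotentResidual_normal G
  obtain ⟨i, m, hpm, hcard⟩ := Nat.exists_eq_pow_mul_and_not_dvd
    (Nat.card_pos (α := nilpotentResidual G)).ne' p hp.ne_one
  set M := torsionIn (nilpotentResidual G) hA m with hM
  have key : ∀ r s : ℕ, r.Prime → s.Prime → r ≠ s → p ≠ r → ∀ x y : G, IsPElement r x →
      IsPElement s y → ⁅x, y⁆ ∈ M := by
    intro r s hr hs' hrs hpr x y hx hy
    have hcL := commutator_mem_nilpotentResidual hr hs' hrs hx hy
    set c := ⁅x, y⁆ with hc
    have hpc : IsPElement p (c ^ m) := by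
      refine ⟨i, ?_⟩
      rw [← pow_mul, mul_comm, ← hcard]
      exact congrArg Subtype.val (pow_card_eq_one' (x := (⟨c, hcL⟩ : nilpotentResidual G)))
    have hxc : Commute x (c ^ m) := hall r hr hpr x hx _ (pow_mem hcL m) hpc
    have hxcM : ⁅x, c⁆ ∈ M := by
      refine ⟨mul_mem (hLn.conj_mem c hcL x) (inv_mem hcL), ?_⟩
      rw [commutatorElement_def, (hA _ (hLn.conj_mem c hcL x) _ (inv_mem hcL)).mul_pow, conj_pow,
        inv_pow, hxc.eq, mul_inv_cancel_right, mul_inv_cancel]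
    obtain ⟨k, hk⟩ := hx
    have hcomm : Commute (QuotientGroup.mk' M x) (QuotientGroup.mk' M c) := by
      rw [← commutatorElement_eq_one_iff_commute, ← map_commutatorElement]
      exact (QuotientGroup.eq_one_iff _).2 hxcM
    -- Modulo M, c commutes with x, and x and c⁻¹x are both killed by r ^ k; so c ^ r ^ k lies in M,
    -- which kills the p-part of c.
    have hconj : y * x * y⁻¹ = c⁻¹ * x := by rw [hc, commutatorElement_def]; group
    have hpow : (y * x * y⁻¹) ^ r ^ k = 1 := by rw [conj_pow, hk]; group
    have hck : c ^ r ^ k ∈ M := by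
      have h1 := congrArg (QuotientGroup.mk' M) hpow
      rw [hconj, map_pow, map_mul, map_inv, hcomm.symm.inv_left.mul_pow, ← map_pow _ x, hk,
        map_one, mul_one, inv_pow, inv_eq_one, ← map_pow] at h1
      exact (QuotientGroup.eq_one_iff _).1 h1
    refine ⟨hcL, hpc.eq_one_of_pow_eq_one (m := r ^ k) ?_ ?_⟩
    · rw [← pow_mul, mul_comm, pow_mul]
      exact hck.2
    · exact ((Nat.coprime_primes hp hr).2 hpr).pow_right k
  have hle : nilpotentResidual G ≤ M := by
    refine nilpotentResidual_le (isNilpotent_quotient_of_commutator_mem ?_)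
    intro r s hr hs' hrs x y hx hy
    by_cases hpr : p = r
    · rw [← commutatorElement_inv]
      exact inv_mem (key s r hs' hr hrs.symm (hpr ▸ hrs) y x hy hx)
    · exact key r s hr hs' hrs hpr x y hx hy
  exact not_dvd_card_torsionIn hp hpm (hd.trans (Subgroup.card_dvd_of_le hle))

/-- The nilpotent residual of a solvable BT-group is a Hall subgroup. -/
theorem IsBTGroup.mem_nilpotentResidual_of_dvd (hG : IsBTGroup G) (hs : Group.IsSolvable G)
    {p : ℕ} (hp : p.Prime) (hd : p ∣ Nat.card (nilpotentResidual G)) {y : G}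
    (hy : IsPElement p y) : y ∈ nilpotentResidual G := by
  have := Fact.mk hp
  have hA : ∀ a ∈ nilpotentResidual G, ∀ b ∈ nilpotentResidual G, Commute a b :=
    fun _ ha _ hb ↦ hG.commute_of_mem_nilpotentResidual hs ha hb
  have hLn := nilpotentResidual_normal G
  obtain ⟨q, hq, hpq, x, hx, a, haL, ha, hxa⟩ := hG.exists_not_commute hs hp hd
  have hxazp := hG.conj_mem_zpowers_of_mem_nilpotentResidual hs hp haL ha
    (hx.coprime_orderOf hp hq hpq)
  have hqp := dvd_sub_one_of_not_commute hp hq hpq hx ha hxazp hxa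
  -- A nontrivial action would give p ∣ q - 1, against q ∣ p - 1.
  have hcommq : ∀ s b : G, IsPElement p s → b ∈ nilpotentResidual G → IsPElement q b →
      Commute s b := by
    intro s b hs' hb hqb
    by_contra hc
    have h1 := dvd_sub_one_of_not_commute hq hp hpq.symm hs' hqb
      (hG.conj_mem_zpowers_of_mem_nilpotentResidual hs hq hb hqb
        (hs'.coprime_orderOf hq hp hpq.symm)) hc
    have h2 := Nat.le_of_dvd (Nat.sub_pos_of_lt hp.one_lt) hqp
    have h3 := Nat.le_of_dvd (Nat.sub_pos_of_lt hq.one_lt) h1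
    have := hp.one_lt
    omega
  obtain ⟨S, hyS⟩ := hy.exists_sylow
  obtain ⟨j, m₁, hqm, hcard⟩ := Nat.exists_eq_pow_mul_and_not_dvd
    (Nat.card_pos (α := nilpotentResidual G)).ne' q hq.ne_one
  have hm₁ : m₁ ≠ 0 := fun h ↦ hqm (h ▸ dvd_zero q)
  obtain ⟨i, m₂, hpm, hcard₂⟩ := Nat.exists_eq_pow_mul_and_not_dvd hm₁ p hp.ne_one
  set R₁ := torsionIn (nilpotentResidual G) hA m₁ with hR₁
  set R := torsionIn (nilpotentResidual G) hA m₂ with hR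
  have hRle : R ≤ R₁ := fun t ht ↦ ⟨ht.1, by rw [hcard₂, mul_comm, pow_mul, ht.2, one_pow]⟩
  set N := (S : Subgroup G) ⊔ R₁ with hN
  have hcardN : Nat.card N ∣ Nat.card S * Nat.card R₁ :=
    card_dvd_of_coe_eq_mul (Subgroup.mul_normal (S : Subgroup G) R₁)
  have hqN : ¬ q ∣ Nat.card N := fun h ↦ by
    rcases hq.dvd_mul.1 (h.trans hcardN) with h | h
    · exact hpq.symm (eq_of_dvd_card_of_isPGroup hp hq S.isPGroup' h)
    · exact not_dvd_card_torsionIn hq hqm h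
  -- R₁ is the q'-part of L. The q-part u of [g, s] commutes with v and s, so a power of u with
  -- exponent prime to q lies in the q'-group N; hence u = 1.
  have hNn : N.Normal := by
    refine sup_normal_of_commutator_mem hp S R₁ fun r hr hrp g hg s hsS ↦ ?_
    have hsp : IsPElement p s := S.isPGroup'.isPElement hsS
    have hcL := commutator_mem_nilpotentResidual hr hp hrp hg hsp
    have hco : (q ^ j).Coprime m₁ := ((Nat.Prime.coprime_iff_not_dvd hq).2 hqm).pow_left j
    obtain ⟨u, hu, v, hv, huv, hu1, hv1⟩ := exists_mul_of_pow_mul_eq_one hco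
      (x := ⁅g, s⁆) (by
        rw [← hcard]
        exact congrArg Subtype.val
          (pow_card_eq_one' (x := (⟨⁅g, s⁆, hcL⟩ : nilpotentResidual G))))
    have huL := Subgroup.zpowers_le.2 hcL hu
    have hvL := Subgroup.zpowers_le.2 hcL hv
    have huq : IsPElement q u := ⟨j, hu1⟩
    obtain ⟨k, hk⟩ := hsp
    have hpow : (u * (v * s)) ^ p ^ k = 1 := by
      rw [← mul_assoc, ← huv, show ⁅g, s⁆ * s = g * s * g⁻¹ by simp [commutatorElement_def],
        conj_pow, hk]
      group
    have hcom : Commute u (v * s) := (hA u huL v hvL).mul_right (hcommq s u ⟨k, hk⟩ huL huq).symm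
    have hvs : v * s ∈ N :=
      mul_mem (Subgroup.mem_sup_right ⟨hvL, hv1⟩) (Subgroup.mem_sup_left hsS)
    rw [hcom.mul_pow] at hpow
    have huN : u ^ p ^ k ∈ N := by
      rw [eq_inv_of_mul_eq_one_left hpow]
      exact inv_mem (pow_mem hvs _)
    have hupk : u ^ p ^ k = 1 := (huq.pow _).eq_one_of_mem hq huN hqN
    have hu0 : u = 1 := huq.eq_one_of_pow_eq_one hupk
      (((Nat.coprime_primes hq hp).2 hpq.symm).pow_right k)
    rw [huv, hu0, one_mul]
    exact ⟨hvL, hv1⟩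
  have hxN : (orderOf x).Coprime (Nat.card N) := by
    obtain ⟨k, hk⟩ := hx
    exact Nat.Coprime.coprime_dvd_left (orderOf_dvd_of_pow_eq_one hk)
      (((Nat.Prime.coprime_iff_not_dvd hq).2 hqN).pow_left k)
  -- ⟨t⟩R involves every prime of N, so x normalises it and acts on t by an exponent modulo R. As
  -- [x, t] lies in L and t does not, this exponent is 1 modulo p, and rigidity applies.
  have hcommR : ∀ t ∈ S, t ∉ nilpotentResidual G →
      Commute (QuotientGroup.mk' R x) (QuotientGroup.mk' R t) := by
    intro t htS htL
    have htp : IsPElement p t := S.isPGroup'.isPElement htS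
    have ht1 : t ≠ 1 := fun h ↦ htL (h ▸ one_mem _)
    have hpt : p ∣ Nat.card (Subgroup.zpowers t ⊔ R : Subgroup G) := by
      refine dvd_trans ?_ (Subgroup.card_dvd_of_le (le_sup_left (a := Subgroup.zpowers t)))
      rw [Nat.card_zpowers]
      exact htp.dvd_orderOf hp ht1
    have hmem : x * t * x⁻¹ ∈ Subgroup.zpowers t ⊔ R := by
      refine hG.conj_mem_of_le_normal (N := N)
        (sup_le_sup (Subgroup.zpowers_le.2 htS) hRle) (fun r hr hrN ↦ ?_) hxN
        (Subgroup.mem_sup_left (Subgroup.mem_zpowers t))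
      by_cases hrp : r = p
      · exact hrp ▸ hpt
      have hrR : r ∣ Nat.card R₁ := (hr.dvd_mul.1 (hrN.trans hcardN)).resolve_left
        fun h ↦ hrp (eq_of_dvd_card_of_isPGroup hp hr S.isPGroup' h)
      have := Fact.mk hr
      obtain ⟨e, he⟩ := exists_prime_orderOf_dvd_card' r hrR
      have heG : orderOf (e : G) = r := by rw [Subgroup.orderOf_coe, he]
      have hrm : r ∣ m₁ := heG ▸ orderOf_dvd_of_pow_eq_one e.2.2
      have hrm₂ : r ∣ m₂ := by
        rw [hcard₂] at hrm
        exact (hr.dvd_mul.1 hrm).resolve_left fun h ↦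
          hrp ((Nat.prime_dvd_prime_iff_eq hr hp).1 (hr.dvd_of_dvd_pow h))
      have heR : (e : G) ∈ R := ⟨e.2.1, orderOf_dvd_iff_pow_eq_one.1 (heG ▸ hrm₂)⟩
      refine dvd_trans ?_ (Subgroup.card_dvd_of_le (le_sup_right (a := Subgroup.zpowers t)))
      have := orderOf_dvd_natCard (⟨e, heR⟩ : R)
      rwa [← Subgroup.orderOf_coe, heG] at this
    obtain ⟨_, ⟨n, rfl⟩, ρ, hρ, he⟩ := Subgroup.mem_sup_of_normal_right.1 hmem
    simp only at he
    have hcL := commutator_mem_nilpotentResidual hq hp hpq.symm hx htp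
    have hn1 : t ^ (n - 1) ∈ nilpotentResidual G := by
      have h1 := mul_mem hcL (hLn.conj_mem _ (inv_mem hρ.1) t)
      rwa [commutatorElement_def, ← he,
        show t ^ n * ρ * t⁻¹ * (t * ρ⁻¹ * t⁻¹) = t ^ (n - 1) by rw [zpow_sub_one]; group] at h1
    have hpn : (p : ℤ) ∣ n - 1 := by
      by_contra h
      exact htL (htp.mem_of_zpow_mem hp h hn1)
    have hbar : QuotientGroup.mk' R x * QuotientGroup.mk' R t * (QuotientGroup.mk' R x)⁻¹
        = QuotientGroup.mk' R t ^ n := by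
      rw [← map_inv, ← map_mul, ← map_mul, ← he, map_mul, map_zpow,
        show QuotientGroup.mk' R ρ = 1 from (QuotientGroup.eq_one_iff _).2 hρ, mul_one]
    have hbar' := pow_conj_eq_zpow_pow hbar (orderOf x)
    rw [← map_pow, pow_orderOf_eq_one, map_one] at hbar'
    have hself := zpow_eq_self_of_modEq_one hp (hx.coprime_orderOf hp hq hpq).symm
      (htp.map (QuotientGroup.mk' R)) hpn (by simpa using hbar'.symm)
    rw [hself] at hbar
    exact mul_inv_eq_iff_eq_mul.1 hbar
  by_contra hyL
  have haS : a ∈ S := hG.mem_sylow_of_mem_nilpotentResidual hs haL ha S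
  have h1 := hcommR y hyS hyL
  -- Both y and ya lie outside L, so x commutes modulo R with each of them, and therefore with a.
  have h2 := hcommR (y * a) (mul_mem hyS haS) fun h ↦ hyL ((Subgroup.mul_mem_cancel_right _ haL).1 h)
  have h3 : Commute (QuotientGroup.mk' R x) (QuotientGroup.mk' R a) := by
    rw [map_mul] at h2
    have := h1.inv_right.mul_right h2
    rwa [inv_mul_cancel_left] at this
  rw [← commutatorElement_eq_one_iff_commute, ← map_commutatorElement] at h3
  have h4 : ⁅x, a⁆ ∈ R := (QuotientGroup.eq_one_iff _).1 h3
  have h5 : IsPElement p ⁅x, a⁆ := ha.isPGroup_zpowers.isPElement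
    (mul_mem hxazp (inv_mem (Subgroup.mem_zpowers a)))
  refine hxa (commutatorElement_eq_one_iff_commute.1 ?_)
  exact h5.eq_one_of_pow_eq_one h4.2 ((Nat.Prime.coprime_iff_not_dvd hp).2 hpm)

theorem IsBTGroup.normal_of_le_nilpotentResidual (hG : IsBTGroup G) (hs : Group.IsSolvable G)
    {H : Subgroup G} (hH : H ≤ nilpotentResidual G) : H.Normal := by
  have key : ∀ p : ℕ, p.Prime → ∀ l ∈ nilpotentResidual G, IsPElement p l →
      (Subgroup.zpowers l).Normal := by
    intro p hp l hl hpl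
    refine normal_of_forall_sylow_le_normalizer fun r hr ↦
      ⟨Classical.arbitrary _, fun g hg t ht ↦ ?_⟩
    have hgr : IsPElement r g := (Sylow.isPGroup' _).isPElement hg
    obtain ⟨i, rfl⟩ := ht
    simp only
    rw [← conj_zpow]
    refine zpow_mem ?_ i
    by_cases hpr : p = r
    · subst hpr
      by_cases hl1 : l = 1
      · simp [hl1]
      have hd : p ∣ Nat.card (nilpotentResidual G) := (hpl.dvd_orderOf hp hl1).trans (by
        have := orderOf_dvd_natCard (⟨l, hl⟩ : nilpotentResidual G)
        rwa [← Subgroup.orderOf_coe] at this)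
      have hgL := hG.mem_nilpotentResidual_of_dvd hs hp hd hgr
      rw [(hG.commute_of_mem_nilpotentResidual hs hgL hl).eq, mul_inv_cancel_right]
      exact Subgroup.mem_zpowers l
    · exact hG.conj_mem_zpowers_of_mem_nilpotentResidual hs hp hl hpl
        (hgr.coprime_orderOf hp hr hpr)
  refine ⟨fun h hh g ↦ ?_⟩
  have hle : H ≤ H.comap (MulAut.conj g).toMonoidHom := by
    refine le_of_forall_isPElement_mem fun p hp t ht hpt ↦ ?_
    exact Subgroup.zpowers_le.2 ht
      ((key p hp t (hH ht) hpt).conj_mem t (Subgroup.mem_zpowers t) g)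
  exact hle hh

/-- ⟨x⟩ is semipermutable in ⟨x⟩L, where the p'-subgroups lie in L and so are normal, and ⟨x⟩L is
semipermutable in G. Hence ⟨x⟩⟨y⟩ is a group of order prime to |L| that contains [x, y] ∈ L. -/
theorem IsBTGroup.commute_of_not_dvd (hG : IsBTGroup G) (hs : Group.IsSolvable G) {p q : ℕ}
    (hp : p.Prime) (hq : q.Prime) (hpq : p ≠ q) (hpL : ¬ p ∣ Nat.card (nilpotentResidual G))
    (hqL : ¬ q ∣ Nat.card (nilpotentResidual G)) {x y : G} (hx : IsPElement p x)
    (hy : IsPElement q y) : Commute x y := by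
  by_cases hx1 : x = 1
  · exact hx1 ▸ Commute.one_left y
  have hLn := nilpotentResidual_normal G
  obtain ⟨S, hxS⟩ := hx.exists_sylow
  have hN : ((S : Subgroup G) ⊔ nilpotentResidual G).Normal :=
    sup_normal_of_commutator_mem hp S _ fun r hr hrp g hg s hsS ↦
      commutator_mem_nilpotentResidual hr hp hrp hg (S.isPGroup'.isPElement hsS)
  set H := Subgroup.zpowers x with hH
  have hpH : p ∣ Nat.card H := by
    rw [hH, Nat.card_zpowers]
    exact hx.dvd_orderOf hp hx1
  have hHL : IsSemipermutable (H ⊔ nilpotentResidual G) := by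
    refine hG.isSemipermutable_of_le_normal
      (sup_le_sup_right (Subgroup.zpowers_le.2 hxS) _) fun r hr hd ↦ ?_
    rcases hr.dvd_mul.1 (hd.trans (card_dvd_of_coe_eq_mul
      (Subgroup.mul_normal (S : Subgroup G) (nilpotentResidual G)))) with h | h
    · rw [eq_of_dvd_card_of_isPGroup hp hr S.isPGroup' h]
      exact hpH.trans (Subgroup.card_dvd_of_le le_sup_left)
    · exact h.trans (Subgroup.card_dvd_of_le le_sup_right)
  have hHsp : IsSemipermutable H := by
    refine hG H (H ⊔ nilpotentResidual G) le_sup_left (fun X hX ↦ ?_) hHL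
    rw [Nat.card_congr (Subgroup.subgroupOfEquivOfLe le_sup_left).toEquiv] at hX
    have hXL : X.map (Subgroup.subtype _) ≤ nilpotentResidual G := by
      rintro _ ⟨e, he, rfl⟩
      obtain ⟨h, hh, l, hl, hhl⟩ := Subgroup.mem_sup_of_normal_right.1 e.2
      have hep : IsPElement p (QuotientGroup.mk' (nilpotentResidual G) (e : G)) := by
        rw [← hhl, map_mul, show QuotientGroup.mk' (nilpotentResidual G) l = 1 from
          (QuotientGroup.eq_one_iff _).2 hl, mul_one]
        exact (hx.isPGroup_zpowers.isPElement hh).map _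
      have hecard : (e : G) ^ Nat.card X = 1 := by
        have := pow_card_eq_one' (x := (⟨e, he⟩ : X))
        exact congrArg (fun t : X ↦ (((t : X) : ↥(H ⊔ nilpotentResidual G)) : G)) this
      refine (QuotientGroup.eq_one_iff (e : G)).1 (hep.eq_one_of_pow_eq_one (m := Nat.card X) ?_
        (hX.coprime_dvd_left hpH))
      rw [← map_pow, hecard, map_one]
    have hXn : X.Normal := by
      have h1 := hG.normal_of_le_nilpotentResidual hs hXL
      have h2 := h1.comap (Subgroup.subtype (H ⊔ nilpotentResidual G))
      rwa [Subgroup.comap_map_eq_self_of_injective (Subgroup.subtype_injective _)] at h2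
    exact permutes_of_normal_right _ _
  have hperm : Permutes H (Subgroup.zpowers y) := by
    refine hHsp _ ?_
    rw [hH, Nat.card_zpowers, Nat.card_zpowers]
    obtain ⟨k, hk⟩ := hy
    exact (hx.coprime_orderOf hq hp hpq.symm).coprime_dvd_right
      (dvd_refl q) |>.pow_right k |>.coprime_dvd_right (orderOf_dvd_of_pow_eq_one hk)
  have hcop : (Nat.card (H ⊔ Subgroup.zpowers y : Subgroup G)).Coprime
      (Nat.card (nilpotentResidual G)) := by
    refine Nat.Coprime.coprime_dvd_left (card_dvd_of_coe_eq_mul hperm.coe_sup) ?_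
    rw [hH, Nat.card_zpowers, Nat.card_zpowers]
    obtain ⟨k, hk⟩ := hy
    obtain ⟨j, hj⟩ := hx
    exact Nat.Coprime.mul_left
      ((((Nat.Prime.coprime_iff_not_dvd hp).2 hpL).pow_left j).coprime_dvd_left
        (orderOf_dvd_of_pow_eq_one hj))
      ((((Nat.Prime.coprime_iff_not_dvd hq).2 hqL).pow_left k).coprime_dvd_left
        (orderOf_dvd_of_pow_eq_one hk))
  have hxT : x ∈ H ⊔ Subgroup.zpowers y := Subgroup.mem_sup_left (Subgroup.mem_zpowers x)
  have hyT : y ∈ H ⊔ Subgroup.zpowers y := Subgroup.mem_sup_right (Subgroup.mem_zpowers y)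
  rw [← commutatorElement_eq_one_iff_commute]
  exact Subgroup.disjoint_def.1 (Subgroup.disjoint_of_coprime_natCard hcop)
    (mul_mem (mul_mem (mul_mem hxT hyT) (inv_mem hxT)) (inv_mem hyT))
    (commutator_mem_nilpotentResidual hp hq hpq hx hy)

/-- Power automorphisms of a cyclic group commute. -/
theorem IsBTGroup.commutator_mem_centralizer_nilpotentResidual (hG : IsBTGroup G)
    (hs : Group.IsSolvable G) (g h : G) :
    ⁅g, h⁆ ∈ Subgroup.centralizer (nilpotentResidual G : Set G) := by
  have hLn := nilpotentResidual_normal G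
  rw [Subgroup.mem_centralizer_iff]
  intro l hl
  set t := (h * g)⁻¹ * l * (h * g) with ht
  have htL : t ∈ nilpotentResidual G := by simpa [ht] using hLn.conj_mem l hl (h * g)⁻¹
  have hn := hG.normal_of_le_nilpotentResidual hs (Subgroup.zpowers_le.2 htL)
  obtain ⟨a, ha⟩ := mem_zpowers_conj_iff.1 (hn.conj_mem t (Subgroup.mem_zpowers t) g)
  obtain ⟨b, hb⟩ := mem_zpowers_conj_iff.1 (hn.conj_mem t (Subgroup.mem_zpowers t) h)
  have e1 : g * h * t * (g * h)⁻¹ = l := by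
    calc g * h * t * (g * h)⁻¹ = g * (h * t * h⁻¹) * g⁻¹ := by group
      _ = h * (g * t * g⁻¹) * h⁻¹ := by
        rw [hb, ← conj_zpow, ha, ← conj_zpow, hb, ← zpow_mul, ← zpow_mul, mul_comm]
      _ = l := by rw [ht]; group
  calc l * ⁅g, h⁆ = g * h * t * (g * h)⁻¹ * ⁅g, h⁆ := by rw [e1]
    _ = ⁅g, h⁆ * l := by rw [ht, commutatorElement_def]; group

/-! ### The `p`-core and the normal `p`-complement -/

theorem pCore_normal (G : Type*) [Group G] (p : ℕ) : (pCore G p).Normal :=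
  Subgroup.sSup_normal _ fun _ h ↦ h.1

theorem isPGroup_pCore (G : Type*) [Group G] (p : ℕ) : IsPGroup p (pCore G p) :=
  Sylow.sSup_of_normal _ (fun _ h ↦ h.2) fun _ h ↦ h.1

theorem IsBTGroup.mem_pCore_iff (hG : IsBTGroup G) (hs : Group.IsSolvable G) {p : ℕ}
    (hp : p.Prime) (hpL : ¬ p ∣ Nat.card (nilpotentResidual G)) {x : G} (hx : IsPElement p x) :
    x ∈ pCore G p ↔ x ∈ Subgroup.centralizer (nilpotentResidual G : Set G) := by
  have hLn := nilpotentResidual_normal G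
  have hCn := pCore_normal G p
  constructor
  · intro hxc
    rw [Subgroup.mem_centralizer_iff]
    intro l hl
    refine (Subgroup.commute_of_normal_of_disjoint _ _ hLn hCn ?_ l x hl hxc)
    rw [Subgroup.disjoint_def]
    exact fun ht ht' ↦ ((isPGroup_pCore G p).isPElement ht').eq_one_of_mem hp ht hpL
  · intro hxc
    obtain ⟨S, hxS⟩ := hx.exists_sylow
    -- Elements of order prime to p centralise S ∩ C(L): those in L by definition, the others
    -- because they commute with p-elements.
    suffices hn : ((S : Subgroup G) ⊓
        Subgroup.centralizer (nilpotentResidual G : Set G)).Normal from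
      (le_sSup ⟨hn, S.isPGroup'.to_inf_left⟩ : _ ≤ pCore G p) ⟨hxS, hxc⟩
    refine normal_of_forall_sylow_le_normalizer fun r hr ↦ ?_
    by_cases hrp : r = p
    · subst hrp
      refine ⟨S, fun g hg t ht ↦ ⟨?_, ?_⟩⟩
      · exact (S : Subgroup G).mul_mem ((S : Subgroup G).mul_mem hg ht.1)
          ((S : Subgroup G).inv_mem hg)
      exact (inferInstance : (Subgroup.centralizer (nilpotentResidual G : Set G)).Normal).conj_mem
        t ht.2 g
    · refine ⟨Classical.arbitrary _, fun g hg t ht ↦ ?_⟩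
      have hgr : IsPElement r g := (Sylow.isPGroup' _).isPElement hg
      suffices h : Commute g t by
        rw [h.eq, mul_inv_cancel_right]
        exact ht
      by_cases hrL : r ∣ Nat.card (nilpotentResidual G)
      · exact Subgroup.mem_centralizer_iff.1 ht.2 g (hG.mem_nilpotentResidual_of_dvd hs hr hrL hgr)
      · exact hG.commute_of_not_dvd hs hr hp hrp hrL hpL hgr (S.isPGroup'.isPElement ht.1)

/-- The preimage of the p-complement of the nilpotent group G/L, where |L| is prime to p. -/
theorem exists_normal_complement {p : ℕ} (hp : p.Prime)
    (hpL : ¬ p ∣ Nat.card (nilpotentResidual G)) :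
    ∃ C : Subgroup G, C.Normal ∧ ¬ p ∣ Nat.card C ∧
      ∀ q : ℕ, q.Prime → q ≠ p → ∀ x : G, IsPElement q x → x ∈ C := by
  have := Fact.mk hp
  have hnil : Group.IsNilpotent (G ⧸ nilpotentResidual G) :=
    isNilpotent_quotient_of_commutator_mem fun _ _ hp hq hpq _ _ hx hy ↦
      commutator_mem_nilpotentResidual hp hq hpq hx hy
  let P : Sylow p (G ⧸ nilpotentResidual G) := Classical.arbitrary _
  have hPn : (P : Subgroup (G ⧸ nilpotentResidual G)).Normal :=
    (Group.isNilpotent_of_finite_tfae (G := G ⧸ nilpotentResidual G)).out 0 3 rfl rfl |>.1 hnil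
      p ⟨hp⟩ P
  obtain ⟨D, hD⟩ := Subgroup.exists_right_complement'_of_coprime P.card_coprime_index
  have hcardD : ¬ p ∣ Nat.card D := by
    rw [← hD.symm.index_eq_card]
    exact P.not_dvd_index
  have hcent : ∀ a ∈ P, ∀ d ∈ D, Commute a d := by
    have : D ≤ Subgroup.centralizer (P : Set (G ⧸ nilpotentResidual G)) := by
      refine le_of_forall_isPElement_mem fun r hr d hd hrd ↦ ?_
      by_cases hrp : r = p
      · subst hrp
        rw [hrd.eq_one_of_mem hr hd hcardD]
        exact one_mem _
      · rw [Subgroup.mem_centralizer_iff]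
        exact fun a ha ↦ commute_of_isNilpotent hp hr (Ne.symm hrp)
          (P.isPGroup'.isPElement ha) hrd
    exact fun a ha d hd ↦ Subgroup.mem_centralizer_iff.1 (this hd) a ha
  have hprod : ∀ g : G ⧸ nilpotentResidual G, ∃ a ∈ P, ∃ d ∈ D, a * d = g := by
    intro g
    obtain ⟨⟨a, d⟩, h⟩ := hD.2 g
    exact ⟨a, a.2, d, d.2, h⟩
  have hDn : D.Normal := by
    refine ⟨fun d hd g ↦ ?_⟩
    obtain ⟨a, ha, e, he, rfl⟩ := hprod g
    have h1 : e * d * e⁻¹ ∈ D := mul_mem (mul_mem he hd) (inv_mem he)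
    rw [show a * e * d * (a * e)⁻¹ = a * (e * d * e⁻¹) * a⁻¹ by group, (hcent a ha _ h1).eq,
      mul_inv_cancel_right]
    exact h1
  refine ⟨D.comap (QuotientGroup.mk' _), hDn.comap _, fun hd ↦ ?_, fun q hq hqp x hx ↦ ?_⟩
  · obtain ⟨e, he⟩ := exists_prime_orderOf_dvd_card' p hd
    have heo : orderOf (e : G) = p := by rw [Subgroup.orderOf_coe, he]
    have hep : IsPElement p (e : G) := ⟨1, by rw [pow_one, ← heo, pow_orderOf_eq_one]⟩
    have h1 := (hep.map (QuotientGroup.mk' (nilpotentResidual G))).eq_one_of_mem hp e.2 hcardD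
    have h2 := hep.eq_one_of_mem hp ((QuotientGroup.eq_one_iff _).1 h1) hpL
    rw [h2, orderOf_one] at heo
    exact hp.one_lt.ne heo
  · rw [Subgroup.mem_comap]
    have hxq := hx.map (QuotientGroup.mk' (nilpotentResidual G))
    obtain ⟨a, ha, d, hd, had⟩ := hprod (QuotientGroup.mk' _ x)
    rw [← had] at hxq ⊢
    obtain ⟨k, hk⟩ := hxq
    rw [(hcent a ha d hd).mul_pow] at hk
    have h1 : a ^ q ^ k ∈ D := by
      rw [eq_inv_of_mul_eq_one_left hk]
      exact inv_mem (pow_mem hd _)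
    have hap := P.isPGroup'.isPElement ha
    have h2 := (hap.pow _).eq_one_of_mem hp h1 hcardD
    rw [hap.eq_one_of_pow_eq_one h2 (((Nat.coprime_primes hp hq).2 (Ne.symm hqp)).pow_right k),
      one_mul]
    exact hd

end Structure

/-! ### SS-permutability in solvable BT-groups -/

section Main

variable {G : Type*} [Group G] [Finite G]

theorem IsBTGroup.isSSPermutable_sylow (hG : IsBTGroup G) (hs : Group.IsSolvable G) {p : ℕ}
    (hp : p.Prime) (hpL : ¬ p ∣ Nat.card (nilpotentResidual G)) (S : Sylow p G) :
    IsSSPermutable (S : Subgroup G) := by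
  obtain ⟨C, hCn, hCp, hCq⟩ := exists_normal_complement hp hpL
  refine ⟨C, ?_, fun r hr Q ↦ ?_⟩
  · rw [IsSupplement, ← Subgroup.mul_normal, eq_top_of_forall_sylow_le (H := (S : Subgroup G) ⊔ C)]
    · rfl
    intro r hr
    by_cases hrp : r = p
    · subst hrp
      exact ⟨S, le_sup_left⟩
    · exact ⟨Classical.arbitrary _, fun x hx ↦ Subgroup.mem_sup_right
        (hCq r hr hrp x ((Sylow.isPGroup' _).isPElement hx))⟩
  · have hQ : IsPGroup r ((Q : Subgroup C).map C.subtype) := Q.isPGroup'.map _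
    by_cases hrL : r ∣ Nat.card (nilpotentResidual G)
    · have := hG.normal_of_le_nilpotentResidual hs
        (H := (Q : Subgroup C).map C.subtype)
        fun x hx ↦ hG.mem_nilpotentResidual_of_dvd hs hr hrL (hQ.isPElement hx)
      exact permutes_of_normal_right _ _
    · refine permutes_of_commute fun x hx y hy ↦ ?_
      by_cases hrp : r = p
      · subst hrp
        rw [(hQ.isPElement hy).eq_one_of_mem hr (Subgroup.map_subtype_le _ hy) hCp]
        exact Commute.one_right x
      · exact hG.commute_of_not_dvd hs hp hr (Ne.symm hrp) hpL hrL (S.isPGroup'.isPElement hx)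
          (hQ.isPElement hy)

theorem isSSPermutable_of_isNilpotent [hG : Group.IsNilpotent G] (H : Subgroup G) :
    IsSSPermutable H := by
  refine ⟨⊤, ?_, fun p hp Q ↦ ?_⟩
  · refine Set.eq_univ_of_forall fun g ↦ ⟨1, H.one_mem, g, Subgroup.mem_top g, one_mul g⟩
  · have hQ : (Q : Subgroup (⊤ : Subgroup G)).Normal :=
      (Group.isNilpotent_of_finite_tfae (G := (⊤ : Subgroup G))).out 0 3 rfl rfl |>.1
        inferInstance p ⟨hp⟩ Q
    have := hQ.map (Subgroup.subtype ⊤) fun g ↦ ⟨⟨g, Subgroup.mem_top g⟩, rfl⟩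
    exact permutes_of_normal_right _ _

/-- The index of L ∩ K in L divides both a power of p and |L|. -/
theorem IsSupplement.nilpotentResidual_le {p : ℕ} (hp : p.Prime)
    (hpL : ¬ p ∣ Nat.card (nilpotentResidual G)) {P K : Subgroup G} (hP : IsPGroup p P)
    (h : IsSupplement P K) : nilpotentResidual G ≤ K := by
  have := Fact.mk hp
  obtain ⟨n, hn⟩ := IsPGroup.iff_card.1 hP
  have h1 : K.index ∣ p ^ n := by
    rw [← hn, ← Subgroup.relIndex_top_right, relIndex_eq_of_coe_eq_mul (H := P)]
    · exact Subgroup.index_dvd_card _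
    · exact h.symm
  have h2 : K.relIndex (nilpotentResidual G) ∣ p ^ n := by
    rw [← relIndex_eq_of_coe_eq_mul (Subgroup.normal_mul (nilpotentResidual G) K)]
    exact (Subgroup.relIndex_dvd_index_of_le le_sup_right).trans h1
  rw [← Subgroup.relIndex_eq_one]
  exact Nat.eq_one_of_dvd_coprimes (((Nat.Prime.coprime_iff_not_dvd hp).2 hpL).pow_left n) h2
    (Subgroup.index_dvd_card _)

theorem Permutes.isPGroup_sup {p : ℕ} (hp : p.Prime) {P Q : Subgroup G} (h : Permutes P Q)
    (hP : IsPGroup p P) (hQ : IsPGroup p Q) : IsPGroup p (P ⊔ Q : Subgroup G) := by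
  have := Fact.mk hp
  obtain ⟨a, ha⟩ := IsPGroup.iff_card.1 hP
  obtain ⟨b, hb⟩ := IsPGroup.iff_card.1 hQ
  refine IsPGroup.of_card_dvd_pow (n := a + b) ?_
  rw [pow_add, ← ha, ← hb]
  exact card_dvd_of_coe_eq_mul h.coe_sup

theorem IsSupplement.isSylowProduct {p : ℕ} (hp : p.Prime) {P K : Subgroup G}
    (hP : IsPGroup p P) (h : IsSupplement P K) (Q : Sylow p K)
    (hQ : Permutes P ((Q : Subgroup K).map K.subtype)) :
    IsSylowProduct p P ((Q : Subgroup K).map K.subtype) := by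
  have := Fact.mk hp
  set T := P ⊔ (Q : Subgroup K).map K.subtype with hT
  have hTp : IsPGroup p T := hQ.isPGroup_sup hp hP (Q.isPGroup'.map _)
  -- G = KT, so |G : T| = |K : K ∩ T|, which divides |K : Q| and is prime to p.
  have h1 : T.index = T.relIndex K := by
    rw [← Subgroup.relIndex_top_right]
    refine relIndex_eq_of_coe_eq_mul (Set.Subset.antisymm (fun g _ ↦ ?_) (Set.subset_univ _))
    obtain ⟨x, hx, k, hk, hxk⟩ : g⁻¹ ∈ (P : Set G) * K := h ▸ Set.mem_univ g⁻¹
    refine ⟨k⁻¹, K.inv_mem hk, x⁻¹, T.inv_mem (Subgroup.mem_sup_left hx), ?_⟩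
    have := congrArg (·⁻¹) hxk
    simpa [mul_inv_rev] using this
  have h2 : T.relIndex K ∣ (Q : Subgroup K).index := by
    have : ((Q : Subgroup K).map K.subtype).relIndex K = (Q : Subgroup K).index := by
      rw [Subgroup.relIndex, Subgroup.subgroupOf,
        Subgroup.comap_map_eq_self_of_injective (Subgroup.subtype_injective _)]
    rw [← this]
    exact Subgroup.relIndex_dvd_of_le_left K le_sup_right
  refine ⟨hTp.toSylow fun hd ↦ Q.not_dvd_index ((h1 ▸ hd).trans h2), ?_⟩
  rw [← hQ.coe_sup, ← hT]
  rfl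

theorem IsBTGroup.exists_of_isSSPermutable (hG : IsBTGroup G) (hs : Group.IsSolvable G) {p : ℕ}
    (hp : p.Prime) (hpL : ¬ p ∣ Nat.card (nilpotentResidual G)) {P : Subgroup G}
    (hP : IsPGroup p P) (hSS : IsSSPermutable P) :
    ∃ K : Subgroup G, IsPGroup p K ∧ IsSylowProduct p P K ∧
      ⁅P, conjClosure K (nilpotentResidual G)⁆ ≤ pCore G p := by
  obtain ⟨K, hsup, hperm⟩ := hSS
  have hLK := hsup.nilpotentResidual_le hp hpL hP
  let Q : Sylow p K := Classical.arbitrary _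
  refine ⟨(Q : Subgroup K).map K.subtype, Q.isPGroup'.map _,
    hsup.isSylowProduct hp hP Q (hperm p hp Q), ?_⟩
  have hn := pCore_normal G p
  -- Centralising P modulo O_p(G) defines a subgroup, so it is enough to test the generating
  -- conjugates.
  let Z := (Subgroup.centralizer ((P.map (QuotientGroup.mk' (pCore G p)) :
    Subgroup (G ⧸ pCore G p)) : Set (G ⧸ pCore G p))).comap (QuotientGroup.mk' (pCore G p))
  have hZ : ∀ g, g ∈ Z ↔ ∀ x ∈ P, ⁅x, g⁆ ∈ pCore G p := by
    intro g
    rw [Subgroup.mem_comap, Subgroup.mem_centralizer_iff]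
    constructor
    · intro h x hx
      have := h _ ⟨x, hx, rfl⟩
      rw [← commutatorElement_eq_one_iff_mul_comm, ← map_commutatorElement] at this
      exact (QuotientGroup.eq_one_iff _).1 this
    · rintro h _ ⟨x, hx, rfl⟩
      rw [← commutatorElement_eq_one_iff_mul_comm, ← map_commutatorElement]
      exact (QuotientGroup.eq_one_iff _).2 (h x hx)
  have hle : conjClosure ((Q : Subgroup K).map K.subtype) (nilpotentResidual G) ≤ Z := by
    refine iSup_le fun l ↦ ?_
    rintro _ ⟨_, ⟨k, hk, rfl⟩, rfl⟩
    refine (hZ _).2 fun x hx ↦ ?_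
    let k₀ : K := ⟨l, hLK l.2⟩
    have hmem : (MulAut.conj (l : G)).toMonoidHom (K.subtype k) ∈
        ((k₀ • Q : Sylow p K) : Subgroup K).map K.subtype := by
      refine ⟨k₀ * k * k₀⁻¹, ?_, rfl⟩
      rw [Sylow.coe_subgroup_smul]
      exact Subgroup.smul_mem_pointwise_smul k (MulAut.conj k₀) _ hk
    have hpT := (hperm p hp (k₀ • Q)).isPGroup_sup hp hP ((k₀ • Q).isPGroup'.map _)
    have h1 := Subgroup.mem_sup_left (T := ((k₀ • Q : Sylow p K) : Subgroup K).map K.subtype) hx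
    have h2 := Subgroup.mem_sup_right (S := P) hmem
    refine (hG.mem_pCore_iff hs hp hpL (hpT.isPElement ?_)).2
      (hG.commutator_mem_centralizer_nilpotentResidual hs _ _)
    exact mul_mem (mul_mem (mul_mem h1 h2) (inv_mem h1)) (inv_mem h2)
  exact Subgroup.commutator_le.2 fun x hx g hg ↦ (hZ g).1 (hle hg) x hx

theorem IsBTGroup.isSSPermutable_of_isSSTGroup (hG : IsBTGroup G) (hs : Group.IsSolvable G)
    (hT : IsSSTGroup G) {p : ℕ} (hp : p.Prime) (hpL : ¬ p ∣ Nat.card (nilpotentResidual G))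
    {P : Subgroup G} (hP : IsPGroup p P) : IsSSPermutable P := by
  have := Fact.mk hp
  obtain ⟨S, hS⟩ := hP.exists_le_sylow
  have : Group.IsNilpotent (S : Subgroup G) := S.isPGroup'.isNilpotent
  exact hT P S hS (isSSPermutable_of_isNilpotent _) (hG.isSSPermutable_sylow hs hp hpL S)

/-! ### From centralising cofactors to SS-permutability of every subgroup -/

/-- A `p`-element centralising all elements of prime order of the nilpotent residual centralises
the residual. -/
theorem IsBTGroup.mem_centralizer_of_forall_prime (hG : IsBTGroup G) (hs : Group.IsSolvable G)
    {p : ℕ} (hp : p.Prime) (hpL : ¬ p ∣ Nat.card (nilpotentResidual G)) {w : G}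
    (hw : IsPElement p w)
    (h : ∀ l ∈ nilpotentResidual G, (orderOf l).Prime → Commute w l) :
    w ∈ Subgroup.centralizer (nilpotentResidual G : Set G) := by
  suffices hle : nilpotentResidual G ≤ Subgroup.centralizer {w} by
    rw [Subgroup.mem_centralizer_iff]
    exact fun l hl ↦ (Subgroup.mem_centralizer_iff.1 (hle hl) w rfl).symm
  refine le_of_forall_isPElement_mem fun r hr l hl hlr ↦ ?_
  rw [Subgroup.mem_centralizer_singleton_iff]
  by_cases hl1 : l = 1
  · simp [hl1]
  have hro := hlr.dvd_orderOf hr hl1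
  have hrp : r ≠ p := by
    rintro rfl
    refine hpL (hro.trans ?_)
    have := orderOf_dvd_natCard (⟨l, hl⟩ : nilpotentResidual G)
    rwa [← Subgroup.orderOf_coe] at this
  have hn := hG.normal_of_le_nilpotentResidual hs (Subgroup.zpowers_le.2 hl)
  obtain ⟨n, hn⟩ := mem_zpowers_conj_iff.1 (hn.conj_mem l (Subgroup.mem_zpowers l) w)
  have hnm := pow_conj_eq_zpow_pow hn (orderOf w)
  rw [pow_orderOf_eq_one] at hnm
  set u := l ^ (orderOf l / r) with hu
  have huo : orderOf u = r := by
    rw [hu, orderOf_pow_of_dvd (Nat.div_pos (Nat.le_of_dvd (orderOf_pos l) hro) hr.pos).ne'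
      (Nat.div_dvd_of_dvd hro), Nat.div_div_self hro (orderOf_pos l).ne']
  have hwu : Commute w u := h u (pow_mem hl _) (huo ▸ hr)
  have hun : u ^ n = u := by
    have : w * u * w⁻¹ = u ^ n := by
      rw [hu, ← conj_pow, hn, ← zpow_natCast, ← zpow_natCast, ← zpow_mul, ← zpow_mul, mul_comm]
    rw [← this, hwu.eq, mul_inv_cancel_right]
  have hdvd : (r : ℤ) ∣ n - 1 := by
    rw [← huo, orderOf_dvd_iff_zpow_eq_one, zpow_sub_one, hun, mul_inv_cancel]
  have := zpow_eq_self_of_modEq_one hr (hw.coprime_orderOf hr hp hrp).symm hlr hdvd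
    (by simpa using hnm.symm)
  rw [this] at hn
  exact (mul_inv_eq_iff_eq_mul.1 hn).symm

/-- The condition on a `p`-element `x` in the third characterisation. -/
def HasCentralizingCofactor (p : ℕ) (x : G) : Prop :=
  ∃ K : Subgroup G, IsPGroup p K ∧ IsSylowProduct p (Subgroup.zpowers x) K ∧
    elemCommutator x (conjClosure K (nilpotentResidual G)) ≤ pCore G p

theorem IsBTGroup.exists_zpow_mul_commute (hG : IsBTGroup G) (hs : Group.IsSolvable G) {p : ℕ}
    (hp : p.Prime) (hpL : ¬ p ∣ Nat.card (nilpotentResidual G)) {x : G}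
    (hx : HasCentralizingCofactor p x) {s : G} (hsp : IsPElement p s) :
    ∃ i : ℤ, ∀ l ∈ nilpotentResidual G, (orderOf l).Prime → ¬ Commute x l →
      Commute (x ^ (-i) * s) l := by
  have := Fact.mk hp
  have hLn := nilpotentResidual_normal G
  obtain ⟨K, hK, ⟨S, hS⟩, hcomm⟩ := hx
  -- If [k, l] ≠ 1 it generates ⟨l⟩, since l has prime order; but x commutes with [k, l].
  have key : ∀ k ∈ K, ∀ l ∈ nilpotentResidual G, (orderOf l).Prime → ¬ Commute x l →
      Commute k l := by
    intro k hk l hl hlp hxl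
    by_contra hkl
    have hn := hG.normal_of_le_nilpotentResidual hs (Subgroup.zpowers_le.2 hl)
    have hcl : ⁅k, l⁆ ∈ Subgroup.zpowers l :=
      mul_mem (hn.conj_mem l (Subgroup.mem_zpowers l) k) (inv_mem (Subgroup.mem_zpowers l))
    have hne : ⁅k, l⁆ ≠ 1 := fun h ↦ hkl (commutatorElement_eq_one_iff_commute.1 h)
    have hmem : ⁅k, l⁆ ∈ conjClosure K (nilpotentResidual G) := by
      have h1 : k ∈ conjClosure K (nilpotentResidual G) :=
        (le_iSup (fun l : nilpotentResidual G ↦ K.map (MulAut.conj (l : G)).toMonoidHom) 1)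
          ⟨k, hk, by simp⟩
      have h2 : l * k⁻¹ * l⁻¹ ∈ conjClosure K (nilpotentResidual G) :=
        (le_iSup (fun l : nilpotentResidual G ↦ K.map (MulAut.conj (l : G)).toMonoidHom) ⟨l, hl⟩)
          ⟨k⁻¹, inv_mem hk, by simp⟩
      rw [show ⁅k, l⁆ = k * (l * k⁻¹ * l⁻¹) by simp [commutatorElement_def, mul_assoc]]
      exact mul_mem h1 h2
    have hcore : x⁻¹ * ⁅k, l⁆⁻¹ * x * ⁅k, l⁆ ∈ pCore G p :=
      hcomm (Subgroup.subset_closure ⟨_, hmem, rfl⟩)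
    have hcL := Subgroup.zpowers_le.2 hl hcl
    have hinL : x⁻¹ * ⁅k, l⁆⁻¹ * x * ⁅k, l⁆ ∈ nilpotentResidual G := by
      refine mul_mem ?_ hcL
      simpa using hLn.conj_mem _ (inv_mem hcL) x⁻¹
    have h1 := ((isPGroup_pCore G p).isPElement hcore).eq_one_of_mem hp hinL hpL
    have hxl' : Commute x ⁅k, l⁆ := by
      have h2 : x⁻¹ * ⁅k, l⁆⁻¹ * x * ⁅k, l⁆ = (⁅k, l⁆ * x)⁻¹ * (x * ⁅k, l⁆) := by group
      rw [h2, inv_mul_eq_one] at h1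
      exact h1.symm
    obtain ⟨n, hn⟩ := hcl
    have hlmem : l ∈ Subgroup.zpowers ⁅k, l⁆ := by
      have hlP : IsPElement (orderOf l) l := ⟨1, by rw [pow_one, pow_orderOf_eq_one]⟩
      refine hlP.mem_of_zpow_mem hlp (n := n) (fun hd ↦ hne ?_) ?_
      · rw [← hn]
        exact orderOf_dvd_iff_zpow_eq_one.1 hd
      · simp only at hn
        rw [hn]
        exact Subgroup.mem_zpowers _
    obtain ⟨m, hm⟩ := hlmem
    exact hxl (hm ▸ hxl'.zpow_right m)
  obtain ⟨S', hsS'⟩ := hsp.exists_sylow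
  -- s need not lie in ⟨x⟩K; replacing it by a conjugate costs a commutator, which centralises L.
  obtain ⟨g, hg⟩ := MulAction.exists_smul_eq G S' S
  have hmem : g * s * g⁻¹ ∈ (S : Set G) := by
    have h1 : MulAut.conj g • s ∈ ((g • S' : Sylow p G) : Subgroup G) := by
      rw [Sylow.coe_subgroup_smul]
      exact Subgroup.smul_mem_pointwise_smul s (MulAut.conj g) _ hsS'
    rw [hg] at h1
    exact h1
  rw [hS] at hmem
  obtain ⟨_, ⟨i, rfl⟩, k, hk, he⟩ := hmem
  simp only at he
  refine ⟨i, fun l hl hlp hxl ↦ ?_⟩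
  have hc := hG.commutator_mem_centralizer_nilpotentResidual hs s g
  have hc' : x ^ (-i) * ⁅s, g⁆ * (x ^ (-i))⁻¹ ∈
      Subgroup.centralizer (nilpotentResidual G : Set G) :=
    (inferInstance : (Subgroup.centralizer (nilpotentResidual G : Set G)).Normal).conj_mem _ hc _
  have e : x ^ (-i) * s = x ^ (-i) * ⁅s, g⁆ * (x ^ (-i))⁻¹ * k := by
    have : k = x ^ (-i) * (g * s * g⁻¹) := by rw [← he]; group
    rw [this, commutatorElement_def]
    group
  rw [e]
  exact Commute.mul_left (Subgroup.mem_centralizer_iff.1 hc' l hl).symm (key k hk l hl hlp hxl)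

/-- Modulo `O_p(G)`, a Sylow `p`-subgroup is generated by any of its nontrivial elements. -/
theorem IsBTGroup.exists_zpow_mul_mem_pCore (hG : IsBTGroup G) (hs : Group.IsSolvable G) {p : ℕ}
    (hp : p.Prime) (hpL : ¬ p ∣ Nat.card (nilpotentResidual G))
    (h : ∀ x : G, IsPElement p x → HasCentralizingCofactor p x) (S : Sylow p G) {x s : G}
    (hxS : x ∈ S) (hsS : s ∈ S) (hx : x ∉ pCore G p) : ∃ i : ℤ, x ^ (-i) * s ∈ pCore G p := by
  have hSp : ∀ t ∈ S, IsPElement p t := fun t ht ↦ S.isPGroup'.isPElement ht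
  have hzz : ∀ b ∈ S, ∀ t ∈ S, ∃ i : ℤ, ∀ l ∈ nilpotentResidual G, (orderOf l).Prime →
      ¬ Commute b l → Commute (b ^ (-i) * t) l := fun b hb t ht ↦
    hG.exists_zpow_mul_commute hs hp hpL (h b (hSp b hb)) (hSp t ht)
  obtain ⟨l₀, hl₀, hl₀p, hxl₀⟩ : ∃ l ∈ nilpotentResidual G, (orderOf l).Prime ∧ ¬ Commute x l := by
    by_contra! hc
    exact hx ((hG.mem_pCore_iff hs hp hpL (hSp x hxS)).2
      (hG.mem_centralizer_of_forall_prime hs hp hpL (hSp x hxS) hc))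
  have key : ∀ l ∈ nilpotentResidual G, (orderOf l).Prime → Commute x l → ∀ t ∈ S,
      Commute t l := by
    intro l hl hlp hxl t ht
    by_contra htl
    -- Comparing x with b gives a power b ^ i centralising l but not l₀, which forces p ∣ i.
    -- Comparing b with b ^ i then makes b ^ (1 - i * j) centralise l₀; as p does not divide 1 - i *
    -- j, so does b.
    obtain ⟨b, hb, hbl, hbl₀⟩ : ∃ b ∈ S, ¬ Commute b l ∧ ¬ Commute b l₀ := by
      by_cases htl₀ : Commute t l₀
      · refine ⟨x * t, mul_mem hxS ht, fun hc ↦ htl ?_, fun hc ↦ hxl₀ ?_⟩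
        · simpa using hxl.inv_left.mul_left hc
        · simpa using hc.mul_left htl₀.inv_left
      · exact ⟨t, ht, htl, htl₀⟩
    obtain ⟨i, hi⟩ := hzz b hb x hxS
    have hi₁ : Commute (b ^ i) l := by
      have := hxl.mul_left (hi l hl hlp hbl).inv_left
      simpa [mul_inv_rev] using this
    have hi₀ : ¬ Commute (b ^ i) l₀ := fun hc ↦ hxl₀ <| by
      simpa using hc.mul_left (hi l₀ hl₀ hl₀p hbl₀)
    obtain ⟨j, hj⟩ := hzz (b ^ i) (zpow_mem hb i) b hb
    have hj₀ : Commute (b ^ (1 - i * j)) l₀ := by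
      have := hj l₀ hl₀ hl₀p hi₀
      rwa [← zpow_mul, ← zpow_add_one, show i * -j + 1 = 1 - i * j by ring] at this
    have hpi : (p : ℤ) ∣ i := by
      by_contra hd
      have := (hSp b hb).mem_of_zpow_mem hp (H := Subgroup.centralizer {l}) hd
        (Subgroup.mem_centralizer_singleton_iff.2 hi₁)
      exact hbl (Subgroup.mem_centralizer_singleton_iff.1 this)
    have hpj : ¬ (p : ℤ) ∣ 1 - i * j := fun hd ↦ by
      have h1 : (p : ℤ) ∣ 1 := by simpa using dvd_add hd (hpi.mul_right j)
      exact (Nat.prime_iff_prime_int.1 hp).not_dvd_one h1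
    have := (hSp b hb).mem_of_zpow_mem hp (H := Subgroup.centralizer {l₀}) hpj
      (Subgroup.mem_centralizer_singleton_iff.2 hj₀)
    exact hbl₀ (Subgroup.mem_centralizer_singleton_iff.1 this)
  obtain ⟨i, hi⟩ := hzz x hxS s hsS
  have hwS : x ^ (-i) * s ∈ S := mul_mem (zpow_mem hxS _) hsS
  refine ⟨i, (hG.mem_pCore_iff hs hp hpL (hSp _ hwS)).2
    (hG.mem_centralizer_of_forall_prime hs hp hpL (hSp _ hwS) fun l hl hlp ↦ ?_)⟩
  by_cases hxl : Commute x l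
  · exact key l hl hlp hxl _ hwS
  · exact hi l hl hlp hxl

theorem IsBTGroup.isSSPermutable_of_hasCentralizingCofactor (hG : IsBTGroup G)
    (hs : Group.IsSolvable G)
    (h : ∀ p : ℕ, p.Prime → ¬ p ∣ Nat.card (nilpotentResidual G) → ∀ x : G, IsPElement p x →
      HasCentralizingCofactor p x) (H : Subgroup G) : IsSSPermutable H := by
  choose C hCn hCp hCq using fun (p : {p : ℕ // p.Prime ∧ ¬ p ∣ Nat.card (nilpotentResidual G) ∧
    ∃ x ∈ H, IsPElement p x ∧ x ∉ pCore G p}) ↦ exists_normal_complement p.2.1 p.2.2.1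
  -- Only the primes p for which H has a p-element outside O_p(G) are cut down. There H supplies the
  -- Sylow subgroup modulo O_p(G), while K keeps only the p-elements of O_p(G).
  let K : Subgroup G := ⨅ p, C p ⊔ pCore G p
  have hcn := pCore_normal G
  have hKn : K.Normal := Subgroup.normal_iInf_normal fun p ↦
    have := hCn p
    inferInstance
  have hcoreK : ∀ r : ℕ, r.Prime → pCore G r ≤ K := by
    intro r hr
    refine le_iInf fun p ↦ ?_
    by_cases hrp : r = p
    · exact hrp ▸ le_sup_right
    · exact fun t ht ↦ Subgroup.mem_sup_left
        (hCq p r hr hrp t ((isPGroup_pCore G r).isPElement ht))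
  have hmem : ∀ p : ℕ, p.Prime → ¬ p ∣ Nat.card (nilpotentResidual G) →
      (∃ x ∈ H, IsPElement p x ∧ x ∉ pCore G p) → ∀ t ∈ K, IsPElement p t → t ∈ pCore G p := by
    intro p hp hpL hbad t ht htp
    have ht' : t ∈ C ⟨p, hp, hpL, hbad⟩ ⊔ pCore G p := Subgroup.mem_iInf.1 ht ⟨p, hp, hpL, hbad⟩
    obtain ⟨c, hc, o, ho, rfl⟩ := Subgroup.mem_sup_of_normal_right.1 ht'
    have htq := htp.map (QuotientGroup.mk' (pCore G p))
    refine (QuotientGroup.eq_one_iff _).1 (htq.eq_one_of_pow_eq_one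
      (m := Nat.card (C ⟨p, hp, hpL, hbad⟩)) ?_
      ((Nat.Prime.coprime_iff_not_dvd hp).2 (hCp ⟨p, hp, hpL, hbad⟩)))
    rw [map_mul, show QuotientGroup.mk' (pCore G p) o = 1 from (QuotientGroup.eq_one_iff _).2 ho,
      mul_one, ← map_pow]
    have : c ^ Nat.card (C ⟨p, hp, hpL, hbad⟩) = 1 :=
      congrArg Subtype.val (pow_card_eq_one' (x := (⟨c, hc⟩ : C ⟨p, hp, hpL, hbad⟩)))
    rw [this, map_one]
  refine ⟨K, ?_, fun p hp Q ↦ ?_⟩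
  · rw [IsSupplement, ← Subgroup.mul_normal, eq_top_of_forall_sylow_le (H := H ⊔ K)]
    · rfl
    intro r hr
    by_cases hbad : ¬ r ∣ Nat.card (nilpotentResidual G) ∧
        ∃ x ∈ H, IsPElement r x ∧ x ∉ pCore G r
    · obtain ⟨hrL, x, hxH, hxr, hx⟩ := hbad
      obtain ⟨S, hxS⟩ := hxr.exists_sylow
      refine ⟨S, fun s hsS ↦ ?_⟩
      obtain ⟨i, hi⟩ := hG.exists_zpow_mul_mem_pCore hs hr hrL (h r hr hrL) S hxS hsS hx
      rw [show s = x ^ i * (x ^ (-i) * s) by group]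
      exact Subgroup.mul_mem_sup (zpow_mem hxH i) (hcoreK r hr hi)
    · refine ⟨Classical.arbitrary _, fun t ht ↦ Subgroup.mem_sup_right ?_⟩
      refine Subgroup.mem_iInf.2 fun p ↦ Subgroup.mem_sup_left (hCq p r hr ?_ t
        ((Sylow.isPGroup' _).isPElement ht))
      rintro rfl
      exact hbad p.2.2
  · have hQ : IsPGroup p ((Q : Subgroup K).map K.subtype) := Q.isPGroup'.map _
    by_cases hpL : p ∣ Nat.card (nilpotentResidual G)
    · have := hG.normal_of_le_nilpotentResidual hs
        (H := (Q : Subgroup K).map K.subtype)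
        fun x hx ↦ hG.mem_nilpotentResidual_of_dvd hs hp hpL (hQ.isPElement hx)
      exact permutes_of_normal_right _ _
    have hcoreQ : ∀ t ∈ pCore G p, t ∈ (Q : Subgroup K).map K.subtype := by
      intro t ht
      have hcp : IsPGroup p ((pCore G p).subgroupOf K) := (isPGroup_pCore G p).comap_subtype
      exact ⟨⟨t, hcoreK p hp ht⟩, hcp.le_sylow_of_normal Q ht, rfl⟩
    refine permutes_of_forall_isPElement fun r hr x hx hxr k hk ↦ ?_
    by_cases hrL : r ∣ Nat.card (nilpotentResidual G)
    · have hn := hG.normal_of_le_nilpotentResidual hs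
        (Subgroup.zpowers_le.2 (hG.mem_nilpotentResidual_of_dvd hs hr hrL hxr))
      refine ⟨k, hk, k⁻¹ * x * k, Subgroup.zpowers_le.2 hx ?_, by group⟩
      simpa using hn.conj_mem x (Subgroup.mem_zpowers x) k⁻¹
    by_cases hrp : r = p
    · subst hrp
      -- Either Q lies in O_r(G), hence equals it and is normal, or all r-elements of H lie in
      -- O_r(G) ≤ Q.
      by_cases hbad : ∃ x ∈ H, IsPElement r x ∧ x ∉ pCore G r
      · have hkc := hmem r hr hrL hbad k (Subgroup.map_subtype_le _ hk) (hQ.isPElement hk)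
        exact ⟨x * k * x⁻¹, hcoreQ _ ((hcn r).conj_mem k hkc x), x, hx, by group⟩
      · push Not at hbad
        exact ⟨x * k, mul_mem (hcoreQ x (hbad x hx hxr)) hk, 1, H.one_mem, mul_one _⟩
    · exact ⟨k, hk, x, hx,
        (hG.commute_of_not_dvd hs hr hp hrp hrL hpL hxr (hQ.isPElement hk)).symm⟩

end Main

end SSPerm

theorem theoremF (G : Type*) [Group G] [Finite G] (hsolv : Group.IsSolvable G)
    (hBT : SSPerm.IsBTGroup G) :
    List.TFAE
      [SSPerm.IsSSTGroup G,
       ∀ p : ℕ, p.Prime → p ∣ Nat.card G → ¬ p ∣ Nat.card (SSPerm.nilpotentResidual G) →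
         ∀ P : Subgroup G, IsPGroup p P →
           ∃ K : Subgroup G, IsPGroup p K ∧ SSPerm.IsSylowProduct p P K ∧
             ⁅P, SSPerm.conjClosure K (SSPerm.nilpotentResidual G)⁆ ≤ SSPerm.pCore G p,
       ∀ p : ℕ, p.Prime → p ∣ Nat.card G → ¬ p ∣ Nat.card (SSPerm.nilpotentResidual G) →
         ∀ x : G, (∃ n : ℕ, orderOf x = p ^ n) →
           ∃ K : Subgroup G, IsPGroup p K ∧
             SSPerm.IsSylowProduct p (Subgroup.zpowers x) K ∧
             SSPerm.elemCommutator x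
               (SSPerm.conjClosure K (SSPerm.nilpotentResidual G)) ≤ SSPerm.pCore G p] := by
  tfae_have 1 → 2 := fun hT p hp _ hpL P hP ↦
    hBT.exists_of_isSSPermutable hsolv hp hpL hP
      (hBT.isSSPermutable_of_isSSTGroup hsolv hT hp hpL hP)
  tfae_have 2 → 3 := by
    rintro h p hp hpG hpL x ⟨n, hn⟩
    have hx : SSPerm.IsPElement p x := ⟨n, by rw [← hn, pow_orderOf_eq_one]⟩
    obtain ⟨K, hK, hprod, hcomm⟩ := h p hp hpG hpL _ hx.isPGroup_zpowers
    refine ⟨K, hK, hprod, le_trans ?_ hcomm⟩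
    rw [SSPerm.elemCommutator, Subgroup.closure_le]
    rintro _ ⟨g, hg, rfl⟩
    -- x⁻¹g⁻¹xg is `⁅x⁻¹, g⁻¹⁆` in the convention of the bracket.
    have := Subgroup.commutator_mem_commutator (inv_mem (Subgroup.mem_zpowers x)) (inv_mem hg)
    simpa [commutatorElement_def] using this
  tfae_have 3 → 1 := by
    intro h H _ _ _ _
    refine hBT.isSSPermutable_of_hasCentralizingCofactor hsolv (fun p hp hpL x hx ↦ ?_) H
    by_cases hpG : p ∣ Nat.card G
    · obtain ⟨k, hk⟩ := hx
      obtain ⟨n, -, hn⟩ := (Nat.dvd_prime_pow hp).1 (orderOf_dvd_of_pow_eq_one hk)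
      exact h p hp hpG hpL x ⟨n, hn⟩
    -- For p prime to |G| the only p-element is 1, and the trivial subgroup is both Sylow subgroup
    -- and cofactor.
    · have := Fact.mk hp
      have hx1 : x = 1 := hx.eq_one_of_mem hp (Subgroup.mem_top x) (by rwa [Subgroup.card_top])
      subst hx1
      refine ⟨⊥, IsPGroup.of_bot, ⟨(IsPGroup.of_bot (G := G)).toSylow ?_, ?_⟩, ?_⟩
      · rwa [Subgroup.index_bot]
      · ext g
        simp
      · rw [SSPerm.elemCommutator, Subgroup.closure_le]
        rintro _ ⟨g, _, rfl⟩
        simp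
  tfae_finish
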